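/- Let $\mathbb{B}=\{u+\mathbf{j}v : u,v\in\mathbb{C}\}$ be the commutative $\mathbb{C}$-algebra of bicomplex numbers, with $\mathbf{j}^2=-1$ and $i\mathbf{j}=\mathbf{j}i$. For $W=u+\mathbf{j}v$ write $\operatorname{Sc}W=u$, $\operatorname{Vec}W=v$, $\overline{W}=u-\mathbf{j}v$, $\langle W,V\rangle_{\mathbb{B}}=\operatorname{Sc}W\,(\operatorname{Sc}V)^*+\operatorname{Vec}W\,(\operatorname{Vec}V)^*$ (where $^*$ is complex conjugation) and $|W|_{\mathbb{B}}=\sqrt{\langle W,W\rangle_{\mathbb{B}}}$. Let $\overline{\boldsymbol\partial}=\frac12\left(\frac{\partial}{\partial x}+\mathbf{j}\frac{\partial}{\partial y}\right)$, $z=x+iy$. Let $\Omega\subset\mathbb{C}$ be a bounded domain and let $f\in C^1(\overline\Omega)\cap C^2(\Omega)\cap W^{2,\infty}(\Omega)$ be a complex-valued function that does not vanish in $\Omega$. Let $\mathcal{A}_f^2(\Omega;\mathbb{B})$ be the space of all $W\in C^1(\Omega;\mathbb{B})$ with $\overline{\boldsymbol\partial}W=\frac{\overline{\boldsymbol\partial}f}{f}\,\overline{W}$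 in $\Omega$ and $\|W\|_{L_2(\Omega;\mathbb{B})}=\left(\iint_\Omega|W|_{\mathbb{B}}^2\,dA\right)^{1/2}<\infty$. Then: 1. For each compact $K\subset\Omega$ there is a constant $C_K>0$ such that $\max_{z\in K}|W(z)|_{\mathbb{B}}\leq C_K\|W\|_{L_2(\Omega;\mathbb{B})}$ for all $W\in\mathcal{A}_f^2(\Omega;\mathbb{B})$. 2. For each $z\in\Omega$ the functionals $W\mapsto\operatorname{Sc}W(z)$ and $W\mapsto\operatorname{Vec}W(z)$ on $\mathcal{A}_f^2(\Omega;\mathbb{B})$ are bounded with respect to $\|\cdot\|_{L_2(\Omega;\mathbb{B})}$. 3. For each $z\in\Omega$ there are unique $K_z,L_z\in\mathcal{A}_f^2(\Omega;\mathbb{B})$ such that, for all $W\in\mathcal{A}_f^2(\Omega;\mathbb{B})$, $$\operatorname{Sc}W(z)=\iint_\Omega\langle W(\zeta),K_z(\zeta)\rangle_{\mathbb{B}}\,dA_\zeta,\qquad \operatorname{Vec}W(z)=\iint_\Omega\langle W(\zeta),L_z(\zeta)\rangle_{\mathbb{B}}\,dA_\zeta .$$ 4. The Bergman kernel $\mathscr{K}_\Omega^f(A;z,\zeta):=\operatorname{Sc}(A)\,K_\zeta(z)+\operatorname{Vec}(A)\,L_\zeta(z)$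 ($A\in\mathbb{B}$, $z,\zeta\in\Omega$) satisfies $\mathscr{K}_\Omega^f(A;\cdot,\zeta)\in\mathcal{A}_f^2(\Omega;\mathbb{B})$ for all $A\in\mathbb{B}$ and $\zeta\in\Omega$, and for all $W\in\mathcal{A}_f^2(\Omega;\mathbb{B})$ and $z\in\Omega$ the function $\zeta\mapsto\mathscr{K}_\Omega^f(W(\zeta);z,\zeta)$ is integrable on $\Omega$ and $$W(z)=\iint_\Omega\mathscr{K}_\Omega^f(W(\zeta);z,\zeta)\,dA_\zeta .$$ -/

import Mathlib

open MeasureTheory Set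
open scoped ContDiff ENNReal ComplexConjugate

/-- The bicomplex numbers `u + j v` with `u v : ℂ`, as a complex vector space with the norm
`√(|u|² + |v|²)`. The product is defined below. -/
abbrev Bicomplex : Type := WithLp 2 (ℂ × ℂ)

namespace Bicomplex

/-- The bicomplex number `u + j v`. -/
def mk (u v : ℂ) : Bicomplex := WithLp.toLp 2 (u, v)

/-- The scalar part of `u + j v`, that is `u`. -/
def Sc (W : Bicomplex) : ℂ := W.fst

/-- The vectorial part of `u + j v`, that is `v`. -/
def Vec (W : Bicomplex) : ℂ := W.snd

/-- The bicomplex product, determined by `j² = -1` and `i j = j i`. -/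
noncomputable instance : Mul Bicomplex :=
  ⟨fun W Z => mk (Sc W * Sc Z - Vec W * Vec Z) (Sc W * Vec Z + Vec W * Sc Z)⟩

/-- The bicomplex unit `j`. -/
noncomputable def j : Bicomplex := mk 0 1

/-- The embedding of the scalars `ℂ` in the bicomplex numbers. -/
noncomputable def ofScalar (a : ℂ) : Bicomplex := mk a 0

/-- The bicomplex conjugation `u + j v ↦ u - j v`. -/
noncomputable def bar (W : Bicomplex) : Bicomplex := mk (Sc W) (-Vec W)

/-- The involution `(u + j v)† = u* - j v*`. -/
noncomputable def dagger (W : Bicomplex) : Bicomplex := mk (conj (Sc W)) (-conj (Vec W))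

/-- The inner product `⟨W, V⟩ = Sc (W V†)`, linear in the first argument. -/
noncomputable def bInner (W V : Bicomplex) : ℂ := Sc (W * dagger V)

theorem bInner_eq (W V : Bicomplex) :
    bInner W V = Sc W * conj (Sc V) + Vec W * conj (Vec V) := by
  change Sc W * conj (Sc V) - Vec W * (-conj (Vec V)) = _
  ring

/-- The norm carried by the type is the one induced by the inner product. -/
theorem bInner_self (W : Bicomplex) : bInner W W = ((‖W‖ ^ 2 : ℝ) : ℂ) := by
  rw [bInner_eq, Complex.mul_conj, Complex.mul_conj, WithLp.prod_norm_sq_eq_of_L2]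
  simp [Sc, Vec, Complex.normSq_eq_norm_sq]

end Bicomplex

open Bicomplex

/-- The bicomplex Cauchy-Riemann operator `½ (∂/∂x + j ∂/∂y)`, with `z = x + i y`. -/
noncomputable def dbar (W : ℂ → Bicomplex) (z : ℂ) : Bicomplex :=
  (1 / 2 : ℂ) • (fderiv ℝ W z 1 + j * fderiv ℝ W z Complex.I)

/-- The main bicomplex Vekua equation `∂̄W = (∂̄f / f) W̄` at the point `z`, for a scalar `f`. -/
def VekuaAt (f : ℂ → ℂ) (W : ℂ → Bicomplex) (z : ℂ) : Prop :=
  dbar W z = ((f z)⁻¹ • dbar (fun ζ => ofScalar (f ζ)) z) * bar (W z)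

/-- `V_f(Ω; 𝔹)`: the `C¹` solutions in `Ω` of the main Vekua equation. Only the values of the
functions on `Ω` matter. -/
def VekuaSolutions (Ω : Set ℂ) (f : ℂ → ℂ) : Set (ℂ → Bicomplex) :=
  {W | ContDiffOn ℝ 1 W Ω ∧ ∀ z ∈ Ω, VekuaAt f W z}

/-- The pseudoanalytic Bergman space `𝒜_f²(Ω; 𝔹)`: the square integrable elements of
`V_f(Ω; 𝔹)`. -/
def BergmanSpace (Ω : Set ℂ) (f : ℂ → ℂ) : Set (ℂ → Bicomplex) :=
  {W | W ∈ VekuaSolutions Ω f ∧ MemLp W 2 (volume.restrict Ω)}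

/-- The norm of `L₂(Ω; 𝔹)`. -/
noncomputable def l2Norm (Ω : Set ℂ) (W : ℂ → Bicomplex) : ℝ :=
  Real.sqrt (∫ z in Ω, ‖W z‖ ^ 2)

/-- The inner product of `L₂(Ω; 𝔹)`. -/
noncomputable def l2Inner (Ω : Set ℂ) (W V : ℂ → Bicomplex) : ℂ :=
  ∫ z in Ω, bInner (W z) (V z)

/-- `f ∈ C¹(closure Ω)`: `f` is `C¹` in the open set `Ω`, and `f` and its first derivative extend
continuously to the closure. -/
def IsC1Closure (Ω : Set ℂ) (f : ℂ → ℂ) : Prop :=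
  ContDiffOn ℝ 1 f Ω ∧ ContinuousOn f (closure Ω) ∧
    ∃ g : ℂ → (ℂ →L[ℝ] ℂ), ContinuousOn g (closure Ω) ∧ ∀ z ∈ Ω, g z = fderiv ℝ f z

/-- `g` is the weak derivative of `f` in `Ω` in the direction `v`. -/
def IsWeakDeriv (Ω : Set ℂ) (v : ℂ) (f g : ℂ → ℂ) : Prop :=
  ∀ φ : ℂ → ℝ, ContDiff ℝ ∞ φ → HasCompactSupport φ → tsupport φ ⊆ Ω →
    ∫ z in Ω, (fderiv ℝ φ z v : ℂ) * f z = -∫ z in Ω, (φ z : ℂ) * g z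

/-- The Sobolev space `W^{k,∞}(Ω)`: `f` and its weak partial derivatives up to the order `k` are
in `L_∞(Ω)`. -/
def MemSobolevInf (Ω : Set ℂ) : ℕ → (ℂ → ℂ) → Prop
  | 0, f => MemLp f ∞ (volume.restrict Ω)
  | k + 1, f => MemLp f ∞ (volume.restrict Ω) ∧
      ∃ fx fy : ℂ → ℂ, IsWeakDeriv Ω 1 f fx ∧ IsWeakDeriv Ω Complex.I f fy ∧
        MemSobolevInf Ω k fx ∧ MemSobolevInf Ω k fy

/-- `K` is an element of the Bergman space that represents `W ↦ Sc W(z)`. -/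
def IsScKernel (Ω : Set ℂ) (f : ℂ → ℂ) (z : ℂ) (K : ℂ → Bicomplex) : Prop :=
  K ∈ BergmanSpace Ω f ∧ ∀ W ∈ BergmanSpace Ω f, Sc (W z) = l2Inner Ω W K

/-- `L` is an element of the Bergman space that represents `W ↦ Vec W(z)`. -/
def IsVecKernel (Ω : Set ℂ) (f : ℂ → ℂ) (z : ℂ) (L : ℂ → Bicomplex) : Prop :=
  L ∈ BergmanSpace Ω f ∧ ∀ W ∈ BergmanSpace Ω f, Vec (W z) = l2Inner Ω W L

/-- The Bergman kernel with coefficient `A`, for the families `K z = K_z` and `L z = L_z` of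
reproducing kernels: `𝒦(A; z, ζ) = Sc(A) K_ζ(z) + Vec(A) L_ζ(z)`. -/
noncomputable def bergmanKernel (K L : ℂ → ℂ → Bicomplex) (A : Bicomplex) (z ζ : ℂ) : Bicomplex :=
  Sc A • K ζ z + Vec A • L ζ z

/-! The main point is an interior estimate: near each point of `Ω`, both `W` and its first
derivative are bounded by the `L₂` norm of `W`. The algebra maps `j ↦ i` and `j ↦ -i` send `W = u +
j v` to `u + i v` and `u - i v`. With `q = u + i v` and `p` the conjugate of `u - i v`, the Vekua
equation becomes a planar system in which `∂̄p` is a `C¹` coefficient times the conjugate of `q`,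
and likewise with `p` and `q` exchanged. The coefficients are `C¹` because `f` is `C²` and has no
zeros.

For such a system the estimate rests on averages against a radial kernel. Rotation invariance makes
the derivative of the average in the radius depend on `∂̄φ` alone, so `φ(z)` differs from its
average at scale `r` by at most `r · sup |∂̄φ|` (`norm_sub_radialMean_le`), and the average is
controlled by the `L₂` norm. The same inequality applied to `φ(· + h) - φ` bounds the gradient
without second derivatives (`norm_fderiv_le_of_wirtingerBar`). Both give a bound `P / r + Q r sup`,
whose last term is absorbed by `le_of_local_estimate`.

Consequently `L₂` convergence in the Bergman space forces locally uniform convergence of the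
functions and their derivatives, so the space is closed in `L₂` (`exists_bergman_of_tendsto`).
Bicomplex conjugation fixes `i`, so the equation is `ℂ`-linear, and Riesz representation gives `K_z`
and `L_z`. Evaluating these kernels on one another gives the Hermitian symmetry that turns the two
scalar reproducing formulas into the bicomplex one (`bergmanKernel_eq_mk`). -/

section

open Metric Complex Filter Topology

/-! ### A Lipschitz radial kernel of integral one. -/

/-- The tent function `max 0 (1 - |ζ|)` on the plane. -/
noncomputable def tent (ζ : ℂ) : ℝ := max 0 (1 - ‖ζ‖)

theorem tent_nonneg (ζ : ℂ) : 0 ≤ tent ζ := le_max_left _ _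

theorem tent_le_one (ζ : ℂ) : tent ζ ≤ 1 :=
  max_le zero_le_one (by linarith [norm_nonneg ζ])

theorem continuous_tent : Continuous tent := by
  unfold tent; fun_prop

theorem tent_eq_zero {ζ : ℂ} (h : ζ ∉ closedBall (0 : ℂ) 1) : tent ζ = 0 := by
  rw [mem_closedBall_zero_iff, not_le] at h
  exact max_eq_left (by linarith)

theorem abs_tent_sub_le (ζ w : ℂ) : |tent ζ - tent w| ≤ ‖ζ - w‖ := by
  unfold tent
  refine (abs_max_sub_max_le_max _ _ _ _).trans ?_
  rw [sub_self, abs_zero, max_eq_right (abs_nonneg _), sub_sub_sub_cancel_left, abs_sub_comm]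
  exact abs_norm_sub_norm_le ζ w

theorem tent_mul {c : ℂ} (hc : ‖c‖ = 1) (ζ : ℂ) : tent (c * ζ) = tent ζ := by
  simp [tent, hc]

theorem integrable_tent : Integrable tent :=
  continuous_tent.integrable_of_hasCompactSupport
    (HasCompactSupport.intro (isCompact_closedBall 0 1) fun _ h => tent_eq_zero h)

theorem integral_tent_pos : 0 < ∫ ζ, tent ζ := by
  refine continuous_tent.integral_pos_of_hasCompactSupport_nonneg_nonzero
    (HasCompactSupport.intro (isCompact_closedBall 0 1) fun _ h => tent_eq_zero h)
    tent_nonneg (x := 0) ?_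
  simp [tent]

/-- The normalised radial kernel with support in the closed unit disc. -/
noncomputable def radialKernel (ζ : ℂ) : ℝ := (∫ w, tent w)⁻¹ * tent ζ

/-- A bound, and a Lipschitz constant, of the radial kernel. -/
noncomputable def radialConst : ℝ := (∫ w, tent w)⁻¹

theorem radialConst_pos : 0 < radialConst := inv_pos.2 integral_tent_pos

theorem radialKernel_nonneg (ζ : ℂ) : 0 ≤ radialKernel ζ :=
  mul_nonneg radialConst_pos.le (tent_nonneg ζ)

theorem radialKernel_le (ζ : ℂ) : radialKernel ζ ≤ radialConst :=
  mul_le_of_le_one_right radialConst_pos.le (tent_le_one ζ)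

theorem continuous_radialKernel : Continuous radialKernel :=
  continuous_const.mul continuous_tent

theorem radialKernel_eq_zero {ζ : ℂ} (h : ζ ∉ closedBall (0 : ℂ) 1) : radialKernel ζ = 0 := by
  rw [radialKernel, tent_eq_zero h, mul_zero]

theorem abs_radialKernel_sub_le (ζ w : ℂ) :
    |radialKernel ζ - radialKernel w| ≤ radialConst * ‖ζ - w‖ := by
  rw [radialKernel, radialKernel, ← mul_sub, abs_mul, abs_of_pos (inv_pos.2 integral_tent_pos)]
  exact mul_le_mul_of_nonneg_left (abs_tent_sub_le ζ w) radialConst_pos.le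

theorem radialKernel_mul {c : ℂ} (hc : ‖c‖ = 1) (ζ : ℂ) :
    radialKernel (c * ζ) = radialKernel ζ := by
  rw [radialKernel, tent_mul hc, radialKernel]

theorem integrable_radialKernel : Integrable radialKernel :=
  integrable_tent.const_mul _

theorem setIntegral_radialKernel : ∫ ζ in closedBall (0 : ℂ) 1, radialKernel ζ = 1 := by
  rw [setIntegral_eq_integral_of_forall_compl_eq_zero fun _ h => radialKernel_eq_zero h]
  unfold radialKernel
  rw [integral_const_mul, inv_mul_cancel₀ integral_tent_pos.ne']

/-! ### Radial means and the mean value estimate. -/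

/-- Twice the Cauchy-Riemann operator of the plane. -/
noncomputable def wirtingerBar (φ : ℂ → ℂ) (w : ℂ) : ℂ :=
  fderiv ℝ φ w 1 + I * fderiv ℝ φ w I

/-- The weighted mean of `φ` over the image of the unit disc under `ζ ↦ z + c ζ`. -/
noncomputable def radialMean (φ : ℂ → ℂ) (z c : ℂ) : ℂ :=
  ∫ ζ in closedBall (0 : ℂ) 1, radialKernel ζ • φ (z + c * ζ)

theorem setIntegral_comp_mul_of_norm_eq_one {E : Type*} [NormedAddCommGroup E] [NormedSpace ℝ E]
    {c : ℂ} (hc : ‖c‖ = 1) (g : ℂ → E) :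
    ∫ ζ in closedBall (0 : ℂ) 1, g (c * ζ) = ∫ ζ in closedBall (0 : ℂ) 1, g ζ := by
  let a : Circle := ⟨c, mem_sphere_zero_iff_norm.2 hc⟩
  have h := (rotation a).measurePreserving.setIntegral_preimage_emb
    (rotation a).toHomeomorph.measurableEmbedding g (closedBall 0 1)
  have hs : (rotation a) ⁻¹' (closedBall 0 1) = closedBall (0 : ℂ) 1 := by
    ext w; rw [mem_preimage, mem_closedBall_zero_iff, mem_closedBall_zero_iff,
      LinearIsometryEquiv.norm_map]
  rw [hs] at h
  exact h

/-- Both the kernel and the disc are rotation invariant, so the mean depends on `c` only through its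
modulus. -/
theorem radialMean_mul {φ : ℂ → ℂ} {z c u : ℂ} (hu : ‖u‖ = 1) :
    radialMean φ z (c * u) = radialMean φ z c := by
  unfold radialMean
  rw [← setIntegral_comp_mul_of_norm_eq_one hu fun ζ => radialKernel ζ • φ (z + c * ζ)]
  simp only [radialKernel_mul hu, mul_assoc]

/-- Write `D ζ = a ζ + b conj ζ`. In `D ζ + I * D (I * ζ)` the `a` terms cancel and `2 b conj ζ`
remains, where `2 b = D 1 + I * D I`. -/
theorem clm_apply_eq_conj_mul_sub (D : ℂ →L[ℝ] ℂ) (ζ : ℂ) :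
    D ζ = conj ζ * (D 1 + I * D I) - I * D (I * ζ) := by
  have h1 : D ζ = ζ.re * D 1 + ζ.im * D I := by
    conv_lhs => rw [show ζ = ζ.re • (1 : ℂ) + ζ.im • I by simp]
    rw [map_add, map_smul, map_smul, real_smul, real_smul]
  have h2 : D (I * ζ) = -ζ.im * D 1 + ζ.re * D I := by
    conv_lhs => rw [show I * ζ = (-ζ.im) • (1 : ℂ) + ζ.re • I by
      apply Complex.ext <;> simp]
    rw [map_add, map_smul, map_smul, real_smul, real_smul, ofReal_neg]
  have h3 : conj ζ = ζ.re - ζ.im * I := by apply Complex.ext <;> simp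
  rw [h1, h2, h3]
  linear_combination (ζ.im * D I) * I_sq

section

variable {φ : ℂ → ℂ} {U : Set ℂ} {z : ℂ} {r : ℝ}

theorem add_mul_mem_closedBall {c ζ : ℂ} {s : ℝ} (hc : ‖c‖ ≤ s) (hζ : ζ ∈ closedBall (0 : ℂ) 1) :
    z + c * ζ ∈ closedBall z s := by
  rw [mem_closedBall_iff_norm, add_sub_cancel_left, norm_mul]
  exact (mul_le_of_le_one_right (norm_nonneg _) (mem_closedBall_zero_iff.1 hζ)).trans hc

theorem continuousOn_radial {E : Type*} [NormedAddCommGroup E] [NormedSpace ℝ E] {g : ℂ → E}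
    {s : ℝ} (hg : ContinuousOn g (closedBall z s)) {c : ℂ} (hc : ‖c‖ ≤ s) :
    ContinuousOn (fun ζ => radialKernel ζ • g (z + c * ζ)) (closedBall (0 : ℂ) 1) :=
  continuous_radialKernel.continuousOn.smul
    (hg.comp (by fun_prop) fun _ h => add_mul_mem_closedBall hc h)

/-- Differentiation under the integral in a complex scale `c`, so that one derivative contains both
the radial direction and the angular one. The larger radius `s` leaves room around `c`. -/
theorem hasFDerivAt_radialMean (hU : IsOpen U) (hφ : ContDiffOn ℝ 1 φ U) {s : ℝ}
    (hzU : closedBall z s ⊆ U) {c : ℂ} (hc : ‖c‖ < s) :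
    HasFDerivAt (radialMean φ z)
      (∫ ζ in closedBall (0 : ℂ) 1,
        radialKernel ζ • (fderiv ℝ φ (z + c * ζ)).comp ((ContinuousLinearMap.mul ℝ ℂ).flip ζ)) c := by
  have hD : ContinuousOn (fderiv ℝ φ) (closedBall z s) :=
    (hφ.continuousOn_fderiv_of_isOpen hU le_rfl).mono hzU
  obtain ⟨B, hB⟩ := (isCompact_closedBall z s).exists_bound_of_continuousOn hD
  have hB0 : 0 ≤ B := (norm_nonneg _).trans
    (hB z (mem_closedBall_self ((norm_nonneg c).trans hc.le)))
  have hmem : ball (0 : ℂ) s ∈ nhds c := isOpen_ball.mem_nhds (mem_ball_zero_iff.2 hc)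
  refine hasFDerivAt_integral_of_dominated_of_fderiv_le
    (F' := fun c ζ => radialKernel ζ •
      (fderiv ℝ φ (z + c * ζ)).comp ((ContinuousLinearMap.mul ℝ ℂ).flip ζ))
    (bound := fun _ => radialConst * B) hmem ?_ ?_ ?_ ?_ ?_ ?_
  · filter_upwards [hmem] with k hk
    exact (continuousOn_radial (hφ.continuousOn.mono hzU)
      (mem_ball_zero_iff.1 hk).le).aestronglyMeasurable measurableSet_closedBall
  · exact (continuousOn_radial (hφ.continuousOn.mono hzU) hc.le).integrableOn_compact
      (isCompact_closedBall 0 1)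
  · refine ContinuousOn.aestronglyMeasurable ?_ measurableSet_closedBall
    refine continuous_radialKernel.continuousOn.smul (ContinuousOn.clm_comp ?_ (by fun_prop))
    exact hD.comp (by fun_prop) fun _ h => add_mul_mem_closedBall hc.le h
  · refine (ae_restrict_iff' measurableSet_closedBall).2 (.of_forall fun ζ hζ k hk => ?_)
    rw [norm_smul, Real.norm_of_nonneg (radialKernel_nonneg ζ)]
    refine mul_le_mul (radialKernel_le ζ) ?_ (norm_nonneg _) radialConst_pos.le
    refine (ContinuousLinearMap.opNorm_comp_le _ _).trans ?_
    rw [← mul_one B]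
    refine mul_le_mul (hB _ (add_mul_mem_closedBall (mem_ball_zero_iff.1 hk).le hζ)) ?_
      (norm_nonneg _) hB0
    refine ContinuousLinearMap.opNorm_le_bound _ zero_le_one fun x => ?_
    simpa [mul_comm] using mul_le_mul_of_nonneg_right (mem_closedBall_zero_iff.1 hζ) (norm_nonneg x)
  · exact (continuousOn_const (c := radialConst * B)).integrableOn_compact (isCompact_closedBall 0 1)
  · refine (ae_restrict_iff' measurableSet_closedBall).2 (.of_forall fun ζ hζ k hk => ?_)
    have hk' := hzU (add_mul_mem_closedBall (z := z) (mem_ball_zero_iff.1 hk).le hζ)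
    have h1 : HasFDerivAt φ (fderiv ℝ φ (z + k * ζ)) (z + k * ζ) :=
      ((hφ.differentiableOn one_ne_zero).differentiableAt (hU.mem_nhds hk')).hasFDerivAt
    have h2 : HasFDerivAt (fun k : ℂ => z + k * ζ) ((ContinuousLinearMap.mul ℝ ℂ).flip ζ) k :=
      ((ContinuousLinearMap.mul ℝ ℂ).flip ζ).hasFDerivAt.const_add z
    exact (h1.comp k h2).const_smul (radialKernel ζ)

/-- The mean value estimate: a function differs from its radial means by at most the radius times
the size of its Cauchy-Riemann derivative. -/
theorem norm_sub_radialMean_le (hU : IsOpen U) (hφ : ContDiffOn ℝ 1 φ U) (hr : 0 < r)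
    (hzU : closedBall z (2 * r) ⊆ U) {G : ℝ} (hG : ∀ w ∈ closedBall z r, ‖wirtingerBar φ w‖ ≤ G) :
    ‖φ z - radialMean φ z r‖ ≤ r * G := by
  have hG0 : 0 ≤ G := (norm_nonneg _).trans (hG z (mem_closedBall_self hr.le))
  have hD : ContinuousOn (fderiv ℝ φ) (closedBall z (2 * r)) :=
    (hφ.continuousOn_fderiv_of_isOpen hU le_rfl).mono hzU
  -- The derivative of the mean at scale `t` in direction `k`: radial for `k = 1`, angular for `k =
  -- I`.
  let D (t : ℝ) (k : ℂ) : ℂ :=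
    ∫ ζ in closedBall (0 : ℂ) 1, radialKernel ζ • fderiv ℝ φ (z + t * ζ) (k * ζ)
  have hint : ∀ t ∈ Icc 0 r, ∀ k : ℂ, IntegrableOn
      (fun ζ => radialKernel ζ • fderiv ℝ φ (z + (t : ℂ) * ζ) (k * ζ)) (closedBall (0 : ℂ) 1) := by
    intro t ht k
    refine ContinuousOn.integrableOn_compact (isCompact_closedBall 0 1) ?_
    refine continuous_radialKernel.continuousOn.smul (ContinuousOn.clm_apply ?_ (by fun_prop))
    refine hD.comp (by fun_prop) fun _ h => add_mul_mem_closedBall ?_ h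
    rw [norm_real, Real.norm_of_nonneg ht.1]; linarith [ht.2]
  have hF : ∀ t ∈ Icc 0 r, ∃ L : ℂ →L[ℝ] ℂ, HasFDerivAt (radialMean φ z) L t ∧ ∀ k, L k = D t k := by
    intro t ht
    have htr : ‖(t : ℂ)‖ < 2 * r := by
      rw [norm_real, Real.norm_of_nonneg ht.1]; linarith [ht.2]
    refine ⟨_, hasFDerivAt_radialMean hU hφ hzU htr, fun k => ?_⟩
    rw [ContinuousLinearMap.integral_apply]
    · rfl
    · refine ContinuousOn.integrableOn_compact (isCompact_closedBall 0 1) ?_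
      refine continuous_radialKernel.continuousOn.smul (ContinuousOn.clm_comp ?_ (by fun_prop))
      exact hD.comp (by fun_prop) fun _ h => add_mul_mem_closedBall htr.le h
  have hrot : ∀ t ∈ Icc 0 r, D t I = 0 := by
    intro t ht
    -- At `t = 0` the orbit of rotations degenerates to a point; there the integrand is odd in `ζ`.
    -- For `t > 0` the mean is constant along the circle of radius `t`.
    rcases ht.1.eq_or_lt with h0 | h0
    · have hneg := setIntegral_comp_mul_of_norm_eq_one (c := -1) (by simp)
        fun ζ => radialKernel ζ • fderiv ℝ φ (z + (t : ℂ) * ζ) (I * ζ)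
      have h1 : (-1 : ℂ) * D t I = D t I := by
        change _ = ∫ ζ in closedBall (0 : ℂ) 1, radialKernel ζ • fderiv ℝ φ (z + t * ζ) (I * ζ)
        have hη (ζ : ℂ) : radialKernel (-ζ) = radialKernel ζ := by
          rw [← neg_one_mul, radialKernel_mul (by simp)]
        rw [← hneg]
        simp only [D, ← h0, hη, ofReal_zero, zero_mul, add_zero, neg_zero, neg_one_mul, mul_neg,
          map_neg, smul_neg, integral_neg]
      linear_combination (-1 / 2 : ℂ) * h1
    · obtain ⟨L, hL, hLD⟩ := hF t ht
      have hexp : HasDerivAt (fun θ : ℝ => (t : ℂ) * exp (θ * I)) ((t : ℂ) * I) 0 := by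
        have h1 : HasDerivAt (fun θ : ℝ => (θ : ℂ) * I) (1 * I) 0 :=
          (ofRealCLM.hasDerivAt (x := 0)).mul_const I
        simpa using (h1.cexp).const_mul (t : ℂ)
      have h2 : HasDerivAt (fun θ : ℝ => radialMean φ z ((t : ℂ) * exp (θ * I)))
          (L ((t : ℂ) * I)) 0 := by
        have hL' : HasFDerivAt (radialMean φ z) L ((t : ℂ) * exp ((0 : ℝ) * I)) := by simpa using hL
        exact hL'.comp_hasDerivAt (0 : ℝ) hexp
      have h3 : L ((t : ℂ) * I) = 0 := by
        refine h2.unique ?_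
        simp only [radialMean_mul (norm_exp_ofReal_mul_I _)]
        exact hasDerivAt_const _ _
      rw [← real_smul, map_smul, smul_eq_zero] at h3
      rw [← hLD]
      exact h3.resolve_left h0.ne'
  have hbound : ∀ t ∈ Icc 0 r, ‖D t 1‖ ≤ G := by
    intro t ht
    -- Adding the vanishing angular derivative leaves only the `∂̄` part of the differential under
    -- the integral.
    have h1 : D t 1 = D t 1 + I * D t I := by rw [hrot t ht, mul_zero, add_zero]
    have h2 : D t 1 + I * D t I = ∫ ζ in closedBall (0 : ℂ) 1,
        radialKernel ζ • (conj ζ * wirtingerBar φ (z + t * ζ)) := by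
      simp only [D]
      rw [← integral_const_mul, ← integral_add (hint t ht 1) ((hint t ht I).const_mul I)]
      refine integral_congr_ae (.of_forall fun ζ => ?_)
      simp only [one_mul]
      rw [clm_apply_eq_conj_mul_sub (fderiv ℝ φ (z + t * ζ)) ζ, wirtingerBar, real_smul,
        real_smul, real_smul]
      ring
    rw [h1, h2]
    calc _ ≤ ∫ ζ in closedBall (0 : ℂ) 1, radialKernel ζ * G := by
          refine norm_integral_le_of_norm_le (integrable_radialKernel.integrableOn.mul_const G) ?_
          refine (ae_restrict_iff' measurableSet_closedBall).2 (.of_forall fun ζ hζ => ?_)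
          rw [norm_smul, Real.norm_of_nonneg (radialKernel_nonneg ζ), norm_mul, norm_conj]
          refine mul_le_mul_of_nonneg_left ?_ (radialKernel_nonneg ζ)
          rw [← one_mul G]
          refine mul_le_mul (mem_closedBall_zero_iff.1 hζ) (hG _ (add_mul_mem_closedBall ?_ hζ))
            (norm_nonneg _) zero_le_one
          rw [norm_real, Real.norm_of_nonneg ht.1]; exact ht.2
      _ = G := by rw [integral_mul_const, setIntegral_radialKernel, one_mul]
  have hz : radialMean φ z ((0 : ℝ) : ℂ) = φ z := by
    simp only [radialMean, ofReal_zero, zero_mul, add_zero]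
    rw [integral_smul_const, setIntegral_radialKernel, one_smul]
  have hmv := norm_image_sub_le_of_norm_deriv_le_segment' (f := fun t : ℝ => radialMean φ z t)
    (f' := fun t => D t 1) (a := 0) (b := r) (C := G) ?_
    (fun t ht => hbound t (Ico_subset_Icc_self ht)) r (right_mem_Icc.2 hr.le)
  · rw [hz, norm_sub_rev, sub_zero, mul_comm] at hmv
    exact hmv
  · intro t ht
    obtain ⟨L, hL, hLD⟩ := hF t ht
    have h1 : HasDerivAt (fun t : ℝ => (t : ℂ)) 1 t := ofRealCLM.hasDerivAt
    have := (hL.comp_hasDerivAt t h1).hasDerivWithinAt (s := Icc 0 r)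
    rwa [hLD] at this

end

/-! ### Moving the centre of the mean, and the gradient estimate. -/

theorem radialMean_eq_integral (φ : ℂ → ℂ) (z c : ℂ) :
    radialMean φ z c = ∫ ζ, radialKernel ζ • φ (z + c * ζ) :=
  setIntegral_eq_integral_of_forall_compl_eq_zero fun ζ h => by
    rw [radialKernel_eq_zero h, zero_smul]

/-- A shift of the centre by `h` is a shift of the kernel by `h / r`. Only the kernel needs to be
Lipschitz; for `φ` a supremum bound suffices. -/
theorem norm_radialMean_sub_le {φ : ℂ → ℂ} {z h : ℂ} {r S : ℝ} (hr : 0 < r) (hh : ‖h‖ ≤ r)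
    (hφ : ContinuousOn φ (closedBall z (2 * r))) (hS : ∀ w ∈ closedBall z (2 * r), ‖φ w‖ ≤ S) :
    ‖radialMean φ (z + h) r - radialMean φ z r‖ ≤
      radialConst * volume.real (closedBall (0 : ℂ) 2) * S / r * ‖h‖ := by
  have hr' : (r : ℂ) ≠ 0 := ofReal_ne_zero.2 hr.ne'
  set k : ℂ := h / r with hk
  have hk1 : ‖k‖ = ‖h‖ / r := by rw [hk, norm_div, norm_real, Real.norm_of_nonneg hr.le]
  have hkle : ‖k‖ ≤ 1 := hk1 ▸ (div_le_one hr).2 hh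
  have hmem : ∀ ζ ∈ closedBall (0 : ℂ) 2, z + r * ζ ∈ closedBall z (2 * r) := by
    intro ζ hζ
    rw [mem_closedBall_iff_norm, add_sub_cancel_left, norm_mul, norm_real,
      Real.norm_of_nonneg hr.le, mul_comm]
    exact mul_le_mul_of_nonneg_right (mem_closedBall_zero_iff.1 hζ) hr.le
  have hc : ContinuousOn (fun ζ => φ (z + r * ζ)) (closedBall 0 2) :=
    hφ.comp (by fun_prop) hmem
  have e1 : radialMean φ (z + h) r =
      ∫ ζ in closedBall (0 : ℂ) 2, radialKernel (ζ - k) • φ (z + r * ζ) := by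
    rw [radialMean_eq_integral, setIntegral_eq_integral_of_forall_compl_eq_zero,
      ← integral_add_right_eq_self (fun ζ => radialKernel (ζ - k) • φ (z + r * ζ)) k]
    · refine integral_congr_ae (.of_forall fun ζ => ?_)
      simp only [add_sub_cancel_right]
      rw [mul_add, hk, mul_div_cancel₀ _ hr', add_right_comm, ← add_assoc]
    · intro ζ hζ
      rw [radialKernel_eq_zero, zero_smul]
      rw [mem_closedBall_zero_iff, not_le] at hζ ⊢
      linarith [norm_sub_norm_le ζ k]
  have e2 : radialMean φ z r =
      ∫ ζ in closedBall (0 : ℂ) 2, radialKernel ζ • φ (z + r * ζ) := by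
    rw [radialMean_eq_integral, setIntegral_eq_integral_of_forall_compl_eq_zero]
    intro ζ hζ
    rw [radialKernel_eq_zero, zero_smul]
    rw [mem_closedBall_zero_iff, not_le] at hζ ⊢
    linarith
  rw [e1, e2, ← integral_sub]
  · refine (norm_setIntegral_le_of_norm_le_const (C := radialConst * ‖k‖ * S)
      (isCompact_closedBall (0 : ℂ) 2).measure_lt_top fun ζ hζ => ?_).trans_eq ?_
    · rw [← sub_smul, norm_smul, Real.norm_eq_abs]
      refine mul_le_mul ((abs_radialKernel_sub_le _ _).trans_eq ?_) (hS _ (hmem ζ hζ))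
        (norm_nonneg _) (mul_nonneg radialConst_pos.le (norm_nonneg _))
      rw [sub_sub_cancel_left, norm_neg]
    · rw [hk1]; ring
  · exact ((continuous_radialKernel.comp (continuous_id.sub continuous_const)).continuousOn.smul
      hc).integrableOn_compact (isCompact_closedBall 0 2)
  · exact (continuous_radialKernel.continuousOn.smul hc).integrableOn_compact
      (isCompact_closedBall 0 2)

theorem wirtingerBar_comp_add_sub {φ : ℂ → ℂ} {w h : ℂ} (h1 : DifferentiableAt ℝ φ w)
    (h2 : DifferentiableAt ℝ φ (w + h)) :
    wirtingerBar (fun ζ => φ (ζ + h) - φ ζ) w = wirtingerBar φ (w + h) - wirtingerBar φ w := by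
  unfold wirtingerBar
  have h3 : DifferentiableAt ℝ (fun ζ => φ (ζ + h)) w := by
    rwa [differentiableAt_comp_add_right]
  rw [fderiv_fun_sub h3 h1, fderiv_comp_add_right]
  simp only [sub_apply]
  ring

/-- The interior gradient estimate for the Cauchy-Riemann operator. -/
theorem norm_fderiv_le_of_wirtingerBar {φ : ℂ → ℂ} {U : Set ℂ} {z : ℂ} {r S G : ℝ}
    (hU : IsOpen U) (hφ : ContDiffOn ℝ 1 φ U) (hr : 0 < r) (hzU : closedBall z (3 * r) ⊆ U)
    (hS : ∀ w ∈ closedBall z (3 * r), ‖φ w‖ ≤ S)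
    (hd : ∀ w ∈ closedBall z (3 * r), DifferentiableAt ℝ (wirtingerBar φ) w)
    (hG : ∀ w ∈ closedBall z (3 * r), ‖fderiv ℝ (wirtingerBar φ) w‖ ≤ G) :
    ‖fderiv ℝ φ z‖ ≤ radialConst * volume.real (closedBall (0 : ℂ) 2) * S / r + r * G := by
  have hz3 : z ∈ closedBall z (3 * r) := mem_closedBall_self (by positivity)
  have hS0 : 0 ≤ S := (norm_nonneg _).trans (hS z hz3)
  have hG0 : 0 ≤ G := (norm_nonneg _).trans (hG z hz3)
  have hdφ : ∀ w ∈ U, DifferentiableAt ℝ φ w := fun w hw =>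
    (hφ.differentiableOn one_ne_zero).differentiableAt (hU.mem_nhds hw)
  have hc := radialConst_pos
  -- Increments replace derivatives of `φ`: since `φ` is only `C¹`, the mean value estimate could
  -- not be applied to its gradient.
  refine (hdφ z (hzU hz3)).hasFDerivAt.le_of_lip' (by positivity) ?_
  filter_upwards [closedBall_mem_nhds z hr] with w hw
  set h := w - z with hh
  have hhr : ‖h‖ ≤ r := by rwa [hh, ← mem_closedBall_iff_norm]
  have hw' : w = z + h := by rw [hh]; ring
  have hadd : ∀ x s, x ∈ closedBall z s → x + h ∈ closedBall z (s + r) := by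
    intro x s hx
    rw [mem_closedBall_iff_norm] at hx ⊢
    rw [add_sub_right_comm]
    exact (norm_add_le _ _).trans (add_le_add hx hhr)
  let V : Set ℂ := U ∩ (fun x => x + h) ⁻¹' U
  have hV : IsOpen V := hU.inter (hU.preimage (by fun_prop))
  have hψ : ContDiffOn ℝ 1 (fun x => φ (x + h) - φ x) V :=
    (hφ.comp (by fun_prop) fun x hx => hx.2).sub (hφ.mono inter_subset_left)
  have hzV : closedBall z (2 * r) ⊆ V := fun x hx =>
    ⟨hzU (closedBall_subset_closedBall (by linarith) hx),
      hzU (closedBall_subset_closedBall (by linarith) (hadd x _ hx))⟩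
  -- The increment has `∂̄` of size at most `G * ‖h‖`, by the mean value inequality for
  -- `wirtingerBar φ` on the ball of radius `3 * r`.
  have key := norm_sub_radialMean_le (G := G * ‖h‖) hV hψ hr hzV fun x hx => by
    have hx2 : x ∈ closedBall z (2 * r) := closedBall_subset_closedBall (by linarith) hx
    rw [wirtingerBar_comp_add_sub (hdφ x (hzV hx2).1) (hdφ _ (hzV hx2).2)]
    have := (convex_closedBall z (3 * r)).norm_image_sub_le_of_norm_fderiv_le (𝕜 := ℝ) hd hG
      (closedBall_subset_closedBall (by linarith) hx2)
      (closedBall_subset_closedBall (by linarith) (hadd x _ hx2))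
    rwa [add_sub_cancel_left] at this
  have hmean : radialMean (fun x => φ (x + h) - φ x) z r =
      radialMean φ (z + h) r - radialMean φ z r := by
    unfold radialMean
    have hcφ : ∀ y, ‖y - z‖ ≤ r → IntegrableOn (fun ζ => radialKernel ζ • φ (y + r * ζ))
        (closedBall (0 : ℂ) 1) := fun y hy => by
      refine (continuousOn_radial (s := r) (hφ.continuousOn.mono ?_) ?_).integrableOn_compact
        (isCompact_closedBall 0 1)
      · refine Subset.trans (closedBall_subset_closedBall' ?_) hzU
        rw [dist_eq_norm]; linarith
      · rw [norm_real, Real.norm_of_nonneg hr.le]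
    rw [← integral_sub (hcφ _ (by rwa [add_sub_cancel_left])) (hcφ _ (by simpa using hr.le))]
    simp only [smul_sub, add_right_comm z h]
  have hm := norm_radialMean_sub_le hr hhr
    (hφ.continuousOn.mono ((closedBall_subset_closedBall (by linarith)).trans hzU))
    (fun x hx => hS x (closedBall_subset_closedBall (by linarith) hx))
  rw [← hmean] at hm
  calc ‖φ w - φ z‖ = ‖(φ (z + h) - φ z - radialMean (fun x => φ (x + h) - φ x) z r) +
        radialMean (fun x => φ (x + h) - φ x) z r‖ := by rw [sub_add_cancel, ← hw']
    _ ≤ r * (G * ‖h‖) + radialConst * volume.real (closedBall (0 : ℂ) 2) * S / r * ‖h‖ :=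
        (norm_add_le _ _).trans (add_le_add key hm)
    _ = _ := by ring

/-! ### Control of the mean by the `L₂` norm. -/

theorem setIntegral_comp_add_mul {z : ℂ} {r : ℝ} (hr : 0 < r) (g : ℂ → ℝ) :
    ∫ ζ in closedBall (0 : ℂ) 1, g (z + r * ζ) = (r ^ 2)⁻¹ * ∫ w in closedBall z r, g w := by
  have h1 := Measure.setIntegral_comp_smul_of_pos volume (fun w => g (z + w))
    (closedBall (0 : ℂ) 1) hr
  rw [smul_unitClosedBall, finrank_real_complex, Real.norm_of_nonneg hr.le] at h1
  simp only [real_smul] at h1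
  rw [h1, smul_eq_mul]
  have h2 := (measurePreserving_add_left volume z).setIntegral_preimage_emb
    (measurableEmbedding_addLeft z) g (closedBall z r)
  rw [← h2]
  congr 3
  ext w
  simp

theorem setIntegral_le_sqrt {s : Set ℂ} (hs : IsCompact s) {g : ℂ → ℝ} (hg : ContinuousOn g s)
    (h0 : ∀ z, 0 ≤ g z) :
    ∫ z in s, g z ≤ √(volume.real s) * √(∫ z in s, g z ^ 2) := by
  have : IsFiniteMeasure (volume.restrict s) := ⟨by simpa using hs.measure_lt_top⟩
  have hgm : MemLp g (ENNReal.ofReal 2) (volume.restrict s) := by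
    obtain ⟨B, hB⟩ := hs.exists_bound_of_continuousOn hg
    exact MemLp.of_bound (hg.aestronglyMeasurable hs.measurableSet) B
      ((ae_restrict_iff' hs.measurableSet).2 (.of_forall hB))
  have h := integral_mul_norm_le_Lp_mul_Lq (p := 2) (q := 2) (f := fun _ : ℂ => (1 : ℝ))
    (by constructor <;> norm_num) (memLp_const _) hgm
  simpa [Real.sqrt_eq_rpow, abs_of_nonneg (h0 _)] using h

/-- Cauchy-Schwarz on the unit disc; the factor `1 / r` is the square root of the area scaling
`r⁻²`. -/
theorem norm_radialMean_le {φ : ℂ → ℂ} {U : Set ℂ} {z : ℂ} {r : ℝ} (hr : 0 < r)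
    (hzU : closedBall z r ⊆ U) (hφ : ContinuousOn φ U)
    (hi : IntegrableOn (fun w => ‖φ w‖ ^ 2) U) :
    ‖radialMean φ z r‖ ≤
      radialConst * √(volume.real (closedBall (0 : ℂ) 1)) * √(∫ w in U, ‖φ w‖ ^ 2) / r := by
  have hnr : ‖(r : ℂ)‖ ≤ r := by rw [norm_real, Real.norm_of_nonneg hr.le]
  have hc : ContinuousOn (fun ζ => ‖φ (z + r * ζ)‖) (closedBall (0 : ℂ) 1) :=
    ((hφ.mono hzU).comp (by fun_prop) fun _ h => add_mul_mem_closedBall hnr h).norm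
  have h1 : ‖radialMean φ z r‖ ≤
      ∫ ζ in closedBall (0 : ℂ) 1, radialConst * ‖φ (z + r * ζ)‖ := by
    refine norm_integral_le_of_norm_le
      ((hc.integrableOn_compact (isCompact_closedBall 0 1)).const_mul _) (.of_forall fun ζ => ?_)
    rw [norm_smul, Real.norm_of_nonneg (radialKernel_nonneg ζ)]
    exact mul_le_mul_of_nonneg_right (radialKernel_le ζ) (norm_nonneg _)
  rw [integral_const_mul] at h1
  have h2 := setIntegral_le_sqrt (isCompact_closedBall (0 : ℂ) 1) hc fun _ => norm_nonneg _
  rw [setIntegral_comp_add_mul hr fun w => ‖φ w‖ ^ 2] at h2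
  have h3 : √((r ^ 2)⁻¹ * ∫ w in closedBall z r, ‖φ w‖ ^ 2) ≤ √(∫ w in U, ‖φ w‖ ^ 2) / r := by
    rw [Real.sqrt_mul (by positivity), Real.sqrt_inv, Real.sqrt_sq hr.le, inv_mul_eq_div]
    gcongr
    · exact .of_forall fun _ => by positivity
  calc ‖radialMean φ z r‖ ≤ radialConst * (√(volume.real (closedBall (0 : ℂ) 1)) *
        (√(∫ w in U, ‖φ w‖ ^ 2) / r)) := h1.trans (mul_le_mul_of_nonneg_left
          (h2.trans (mul_le_mul_of_nonneg_left h3 (Real.sqrt_nonneg _))) radialConst_pos.le)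
    _ = _ := by ring

/-! ### Absorption, and interior estimates for the first order system. -/

/-- A local estimate with a small multiple of the supremum on the right hand side gives a bound on
the ball of half the radius. -/
theorem le_of_local_estimate {h : ℂ → ℝ} {z₀ : ℂ} {R P Q : ℝ} (hR : 0 < R) (hR1 : R ≤ 1)
    (hP : 0 ≤ P) (hQ : 0 ≤ Q) (hc : ContinuousOn h (closedBall z₀ R))
    (h0 : ∀ z ∈ closedBall z₀ R, 0 ≤ h z)
    (H : ∀ z r T, 0 < r → r ≤ 1 → closedBall z (3 * r) ⊆ closedBall z₀ R →
      (∀ w ∈ closedBall z (3 * r), h w ≤ T) → h z ≤ P / r + Q * r * T) :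
    ∀ z ∈ closedBall z₀ (R / 2), h z ≤ 4 * (6 + 4 * Q) / R * P := by
  have hdc : ContinuousOn (fun z => R - dist z z₀) (closedBall z₀ R) := by fun_prop
  -- The weight vanishes on the boundary circle, so a bound for the weighted maximum `S` needs no
  -- boundary information.
  obtain ⟨z, hz, hmax⟩ := (isCompact_closedBall z₀ R).exists_isMaxOn
    ⟨z₀, mem_closedBall_self hR.le⟩ (hc.mul hdc)
  set S := h z * (R - dist z z₀) with hS
  have hmax' : ∀ w ∈ closedBall z₀ R, h w * (R - dist w z₀) ≤ S := fun w hw => hmax hw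
  have hSle : S ≤ 2 * (6 + 4 * Q) * P := by
    rcases (sub_nonneg.2 (mem_closedBall.1 hz)).eq_or_lt with hd | hd
    · rw [hS, ← hd, mul_zero]; positivity
    set d := R - dist z z₀ with hdd
    have hdR : d ≤ 1 := by linarith [dist_nonneg (x := z) (y := z₀)]
    -- This choice gives `3 * r ≤ d / 2`, so the weight is at least `d / 2` and `h ≤ 2 * S / d` on
    -- the ball used by `H`. It also gives `4 * (Q * r) ≤ d ≤ 1`, so at most half of `S` returns on
    -- the right and is absorbed.
    set r := d / (6 + 4 * Q) with hr
    have hr0 : 0 < r := by positivity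
    have hrd : r * (6 + 4 * Q) = d := by rw [hr]; field_simp
    have h3r : 3 * r ≤ d / 2 := by nlinarith [mul_nonneg hr0.le hQ]
    have hdist : ∀ w ∈ closedBall z (3 * r), d / 2 ≤ R - dist w z₀ := by
      intro w hw
      linarith [dist_triangle w z z₀, mem_closedBall.1 hw]
    have hsub : closedBall z (3 * r) ⊆ closedBall z₀ R := fun w hw =>
      mem_closedBall.2 (by linarith [hdist w hw])
    have hT := H z r (2 * S / d) hr0 (by linarith) hsub fun w hw => by
      rw [le_div_iff₀ hd]
      nlinarith [hmax' w (hsub hw), mul_le_mul_of_nonneg_left (hdist w hw) (h0 w (hsub hw))]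
    have hS0 : 0 ≤ S := mul_nonneg (h0 z hz) hd.le
    have e1 : P / r * d = (6 + 4 * Q) * P := by rw [← hrd]; field_simp
    have e2 : Q * r * (2 * S / d) * d = 2 * (Q * r) * S := by field_simp
    have h4 : S ≤ (6 + 4 * Q) * P + 2 * (Q * r) * S := by
      rw [← e1, ← e2, ← add_mul]
      exact mul_le_mul_of_nonneg_right hT hd.le
    have h5 : 4 * (Q * r) ≤ 1 := by nlinarith
    nlinarith [mul_le_mul_of_nonneg_right h5 hS0]
  intro w hw
  have hwR : w ∈ closedBall z₀ R := closedBall_subset_closedBall (by linarith) hw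
  have h6 : h w * (R / 2) ≤ S :=
    (mul_le_mul_of_nonneg_left (by linarith [mem_closedBall.1 hw]) (h0 w hwR)).trans (hmax' w hwR)
  rw [div_mul_eq_mul_div, le_div_iff₀ hR]
  linarith

/-- The product rule for the right hand side of the system. The bound is linear in the gradient of
`q`, as the absorption argument requires. -/
theorem norm_fderiv_mul_conj_le {A q : ℂ → ℂ} {w : ℂ} {M S T : ℝ} (hA : DifferentiableAt ℝ A w)
    (hq : DifferentiableAt ℝ q w) (hAM : ‖A w‖ ≤ M) (hDA : ‖fderiv ℝ A w‖ ≤ M) (hS : ‖q w‖ ≤ S)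
    (hT : ‖fderiv ℝ q w‖ ≤ T) :
    ‖fderiv ℝ (fun w => A w * conj (q w)) w‖ ≤ M * (S + T) := by
  have h1 : HasFDerivAt (fun w => conj (q w)) (conjCLE.toContinuousLinearMap.comp (fderiv ℝ q w)) w :=
    conjCLE.toContinuousLinearMap.hasFDerivAt.comp w hq.hasFDerivAt
  have hM : 0 ≤ M := (norm_nonneg _).trans hAM
  rw [(hA.hasFDerivAt.fun_mul h1).fderiv]
  refine (norm_add_le _ _).trans ?_
  rw [norm_smul, norm_smul, norm_conj, mul_add, add_comm]
  refine add_le_add ?_ ?_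
  · rw [mul_comm]
    exact mul_le_mul hDA hS (norm_nonneg _) hM
  · refine mul_le_mul hAM (le_trans ?_ hT) (norm_nonneg _) hM
    refine ContinuousLinearMap.opNorm_le_bound _ (norm_nonneg _) fun v => ?_
    simpa using (fderiv ℝ q w).le_opNorm v

/-- Interior estimates, of the supremum and of the gradient by the `L₂` norm, for the solutions of
a first order system with `C¹` coefficients. -/
theorem exists_interior_estimate {U : Set ℂ} (hU : IsOpen U) {A B : ℂ → ℂ}
    (hA : ContDiffOn ℝ 1 A U) (hB : ContDiffOn ℝ 1 B U) {z₀ : ℂ} (hz₀ : z₀ ∈ U) :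
    ∃ R > 0, closedBall z₀ R ⊆ U ∧ ∃ C : ℝ, 0 < C ∧ ∀ (p q : ℂ → ℂ) (N : ℝ),
      ContDiffOn ℝ 1 p U → ContDiffOn ℝ 1 q U →
      (∀ w ∈ U, wirtingerBar p w = A w * conj (q w)) →
      (∀ w ∈ U, wirtingerBar q w = B w * conj (p w)) →
      IntegrableOn (fun w => ‖p w‖ ^ 2) U → IntegrableOn (fun w => ‖q w‖ ^ 2) U →
      √(∫ w in U, ‖p w‖ ^ 2) ≤ N → √(∫ w in U, ‖q w‖ ^ 2) ≤ N →
      ∀ z ∈ closedBall z₀ R, ‖p z‖ + ‖q z‖ ≤ C * N ∧ ‖fderiv ℝ p z‖ + ‖fderiv ℝ q z‖ ≤ C * N := by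
  obtain ⟨R', hR', hR'U⟩ := nhds_basis_closedBall.mem_iff.1 (hU.mem_nhds hz₀)
  set R := min R' 1 with hRdef
  have hR : 0 < R := lt_min hR' one_pos
  have hR1 : R ≤ 1 := min_le_right _ _
  have hRU : closedBall z₀ R ⊆ U := (closedBall_subset_closedBall (min_le_left _ _)).trans hR'U
  have hdiff : ∀ {g : ℂ → ℂ}, ContDiffOn ℝ 1 g U → ∀ w ∈ U, DifferentiableAt ℝ g w :=
    fun hg w hw => (hg.differentiableOn one_ne_zero).differentiableAt (hU.mem_nhds hw)
  have hbd : ∀ {g : ℂ → ℂ}, ContDiffOn ℝ 1 g U → ∃ M, ∀ w ∈ closedBall z₀ R,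
      ‖g w‖ ≤ M ∧ ‖fderiv ℝ g w‖ ≤ M := by
    intro g hg
    obtain ⟨M₁, h₁⟩ := (isCompact_closedBall z₀ R).exists_bound_of_continuousOn
      (hg.continuousOn.mono hRU)
    obtain ⟨M₂, h₂⟩ := (isCompact_closedBall z₀ R).exists_bound_of_continuousOn
      ((hg.continuousOn_fderiv_of_isOpen hU le_rfl).mono hRU)
    exact ⟨max M₁ M₂, fun w hw => ⟨(h₁ w hw).trans (le_max_left _ _),
      (h₂ w hw).trans (le_max_right _ _)⟩⟩
  obtain ⟨MA, hMA⟩ := hbd hA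
  obtain ⟨MB, hMB⟩ := hbd hB
  set M := max MA MB with hM
  have hM0 : 0 ≤ M := ((norm_nonneg _).trans (hMA z₀ (mem_closedBall_self hR.le)).1).trans
    (le_max_left _ _)
  have hMA' : ∀ w ∈ closedBall z₀ R, ‖A w‖ ≤ M ∧ ‖fderiv ℝ A w‖ ≤ M := fun w hw =>
    ⟨(hMA w hw).1.trans (le_max_left _ _), (hMA w hw).2.trans (le_max_left _ _)⟩
  have hMB' : ∀ w ∈ closedBall z₀ R, ‖B w‖ ≤ M ∧ ‖fderiv ℝ B w‖ ≤ M := fun w hw =>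
    ⟨(hMB w hw).1.trans (le_max_right _ _), (hMB w hw).2.trans (le_max_right _ _)⟩
  set c₁ := radialConst * √(volume.real (closedBall (0 : ℂ) 1)) with hc₁
  set c₂ := radialConst * volume.real (closedBall (0 : ℂ) 2) with hc₂
  have hc₁0 : 0 ≤ c₁ := mul_nonneg radialConst_pos.le (Real.sqrt_nonneg _)
  have hc₂0 : 0 ≤ c₂ := mul_nonneg radialConst_pos.le measureReal_nonneg
  -- `C₁` and `C₂` are the outputs of `le_of_local_estimate` for the sum of the two suprema on
  -- radius `R` and the sum of the two gradients on radius `R / 2`. Each use halves the radius,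
  -- whence `R / 4`.
  set C₁ := 4 * (6 + 4 * (2 * M)) / R * (2 * c₁) with hC₁
  set C₂ := 4 * (6 + 4 * (2 * M)) / (R / 2) * (2 * (c₂ + M) * C₁) with hC₂
  have hC₁0 : 0 ≤ C₁ := by positivity
  have hC₂0 : 0 ≤ C₂ := by positivity
  refine ⟨R / 4, by positivity, (closedBall_subset_closedBall (by linarith)).trans hRU,
    C₁ + C₂ + 1, by positivity, fun p q N hp hq hpq hqp hip hiq hpN hqN => ?_⟩
  have hN : 0 ≤ N := (Real.sqrt_nonneg _).trans hpN
  have sup_step : ∀ {A p q : ℂ → ℂ}, ContDiffOn ℝ 1 p U →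
      (∀ w ∈ U, wirtingerBar p w = A w * conj (q w)) → IntegrableOn (fun w => ‖p w‖ ^ 2) U →
      √(∫ w in U, ‖p w‖ ^ 2) ≤ N → (∀ w ∈ closedBall z₀ R, ‖A w‖ ≤ M) →
      ∀ z r T, 0 < r → closedBall z (3 * r) ⊆ closedBall z₀ R →
      (∀ w ∈ closedBall z (3 * r), ‖q w‖ ≤ T) → ‖p z‖ ≤ c₁ * N / r + r * (M * T) := by
    intro A p q hp hpq hip hpN hA z r T hr hz hT
    have hz' : closedBall z r ⊆ closedBall z (3 * r) := closedBall_subset_closedBall (by linarith)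
    have h1 := norm_sub_radialMean_le (G := M * T) hU hp hr
      (((closedBall_subset_closedBall (by linarith)).trans hz).trans hRU) fun w hw => by
        rw [hpq w (hRU (hz (hz' hw))), norm_mul, norm_conj]
        exact mul_le_mul (hA w (hz (hz' hw))) (hT w (hz' hw)) (norm_nonneg _) hM0
    have h2 : ‖radialMean p z r‖ ≤ c₁ * N / r :=
      (norm_radialMean_le hr ((hz'.trans hz).trans hRU) hp.continuousOn hip).trans (by gcongr)
    calc ‖p z‖ = ‖radialMean p z r + (p z - radialMean p z r)‖ := by rw [add_sub_cancel]
      _ ≤ _ := (norm_add_le _ _).trans (add_le_add h2 h1)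
  have hsup : ∀ z ∈ closedBall z₀ (R / 2), ‖p z‖ + ‖q z‖ ≤ C₁ * N := by
    intro z hz
    refine (le_of_local_estimate (h := fun z => ‖p z‖ + ‖q z‖) (P := 2 * (c₁ * N)) (Q := 2 * M)
      hR hR1 (by positivity) (by positivity)
      ((hp.continuousOn.mono hRU).norm.add (hq.continuousOn.mono hRU).norm)
      (fun z _ => by positivity) ?_ z hz).trans_eq (by rw [hC₁]; ring)
    intro z r T hr _ hz hT
    have h1 := sup_step hp hpq hip hpN (fun w hw => (hMA' w hw).1) z r T hr hz
      fun w hw => (le_add_of_nonneg_left (norm_nonneg _)).trans (hT w hw)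
    have h2 := sup_step hq hqp hiq hqN (fun w hw => (hMB' w hw).1) z r T hr hz
      fun w hw => (le_add_of_nonneg_right (norm_nonneg _)).trans (hT w hw)
    exact (add_le_add h1 h2).trans_eq (by ring)
  have hR2 : closedBall z₀ (R / 2) ⊆ closedBall z₀ R := closedBall_subset_closedBall (by linarith)
  set S := C₁ * N with hS
  have hS0 : 0 ≤ S := by positivity
  have grad_step : ∀ {A p q : ℂ → ℂ}, ContDiffOn ℝ 1 A U → ContDiffOn ℝ 1 p U →
      ContDiffOn ℝ 1 q U → (∀ w ∈ U, wirtingerBar p w = A w * conj (q w)) →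
      (∀ w ∈ closedBall z₀ R, ‖A w‖ ≤ M ∧ ‖fderiv ℝ A w‖ ≤ M) →
      (∀ w ∈ closedBall z₀ (R / 2), ‖p w‖ ≤ S) → (∀ w ∈ closedBall z₀ (R / 2), ‖q w‖ ≤ S) →
      ∀ z r T, 0 < r → r ≤ 1 → closedBall z (3 * r) ⊆ closedBall z₀ (R / 2) →
      (∀ w ∈ closedBall z (3 * r), ‖fderiv ℝ q w‖ ≤ T) →
      ‖fderiv ℝ p z‖ ≤ (c₂ + M) * S / r + r * (M * T) := by
    intro A p q hA hp hq hpq hAM hpS hqS z r T hr hr1 hz hT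
    have heq : ∀ w ∈ U, wirtingerBar p =ᶠ[nhds w] fun w => A w * conj (q w) := fun w hw => by
      filter_upwards [hU.mem_nhds hw] with x hx using hpq x hx
    have hzU := (hz.trans hR2).trans hRU
    have h1 := norm_fderiv_le_of_wirtingerBar (S := S) (G := M * (S + T)) hU hp hr hzU
      (fun w hw => hpS w (hz hw))
      (fun w hw => by
        refine (heq w (hzU hw)).differentiableAt_iff.2 ((hdiff hA w (hzU hw)).mul ?_)
        exact conjCLE.differentiableAt.comp w (hdiff hq w (hzU hw)))
      (fun w hw => by
        rw [(heq w (hzU hw)).fderiv_eq]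
        exact norm_fderiv_mul_conj_le (hdiff hA w (hzU hw)) (hdiff hq w (hzU hw))
          (hAM w (hR2 (hz hw))).1 (hAM w (hR2 (hz hw))).2 (hqS w (hz hw)) (hT w hw))
    refine h1.trans ?_
    -- Since `r ≤ 1`, this lower order term can join the `1 / r` term, which gives the form `P / r +
    -- Q * r * T`.
    have h2 : r * (M * S) ≤ M * S / r := by
      rw [le_div_iff₀ hr]
      have : r * r ≤ 1 := mul_le_one₀ hr1 hr.le hr1
      nlinarith [mul_nonneg hM0 hS0]
    calc _ = c₂ * S / r + r * (M * S) + r * (M * T) := by ring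
      _ ≤ c₂ * S / r + M * S / r + r * (M * T) := by linarith
      _ = _ := by ring
  have hpS : ∀ w ∈ closedBall z₀ (R / 2), ‖p w‖ ≤ S := fun w hw =>
    (le_add_of_nonneg_right (norm_nonneg _)).trans (hsup w hw)
  have hqS : ∀ w ∈ closedBall z₀ (R / 2), ‖q w‖ ≤ S := fun w hw =>
    (le_add_of_nonneg_left (norm_nonneg _)).trans (hsup w hw)
  have hgrad : ∀ z ∈ closedBall z₀ (R / 4), ‖fderiv ℝ p z‖ + ‖fderiv ℝ q z‖ ≤ C₂ * N := by
    intro z hz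
    refine (le_of_local_estimate (h := fun z => ‖fderiv ℝ p z‖ + ‖fderiv ℝ q z‖)
      (P := 2 * ((c₂ + M) * S)) (Q := 2 * M) (half_pos hR) (by linarith) (by positivity)
      (by positivity)
      (((hp.continuousOn_fderiv_of_isOpen hU le_rfl).mono (hR2.trans hRU)).norm.add
        ((hq.continuousOn_fderiv_of_isOpen hU le_rfl).mono (hR2.trans hRU)).norm)
      (fun z _ => by positivity) ?_ z (by rwa [show R / 2 / 2 = R / 4 by ring])).trans_eq
      (by rw [hC₂, hS]; ring)
    intro z r T hr hr1 hz hT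
    have h1 := grad_step hA hp hq hpq hMA' hpS hqS z r T hr hr1 hz
      fun w hw => (le_add_of_nonneg_left (norm_nonneg _)).trans (hT w hw)
    have h2 := grad_step hB hq hp hqp hMB' hqS hpS z r T hr hr1 hz
      fun w hw => (le_add_of_nonneg_right (norm_nonneg _)).trans (hT w hw)
    exact (add_le_add h1 h2).trans_eq (by ring)
  intro z hz
  refine ⟨(hsup z (closedBall_subset_closedBall (by linarith) hz)).trans ?_,
    (hgrad z hz).trans ?_⟩
  · exact mul_le_mul_of_nonneg_right (by linarith) hN
  · exact mul_le_mul_of_nonneg_right (by linarith) hN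

/-! ### Components of bicomplex numbers. -/

namespace Bicomplex

/-- The scalar part as a continuous linear map. -/
noncomputable def scL : Bicomplex →L[ℂ] ℂ := WithLp.fstL 2 ℂ ℂ ℂ

/-- The vectorial part as a continuous linear map. -/
noncomputable def vecL : Bicomplex →L[ℂ] ℂ := WithLp.sndL 2 ℂ ℂ ℂ

theorem Sc_mk (u v : ℂ) : Sc (mk u v) = u := rfl

theorem Vec_mk (u v : ℂ) : Vec (mk u v) = v := rfl

theorem Sc_add (W V : Bicomplex) : Sc (W + V) = Sc W + Sc V := rfl

theorem Vec_add (W V : Bicomplex) : Vec (W + V) = Vec W + Vec V := rfl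

theorem Sc_smul (c : ℂ) (W : Bicomplex) : Sc (c • W) = c * Sc W := rfl

theorem Vec_smul (c : ℂ) (W : Bicomplex) : Vec (c • W) = c * Vec W := rfl

theorem Sc_mul (W V : Bicomplex) : Sc (W * V) = Sc W * Sc V - Vec W * Vec V := rfl

theorem Vec_mul (W V : Bicomplex) : Vec (W * V) = Sc W * Vec V + Vec W * Sc V := rfl

theorem Sc_bar (W : Bicomplex) : Sc (bar W) = Sc W := rfl

theorem Vec_bar (W : Bicomplex) : Vec (bar W) = -Vec W := rfl

theorem Sc_j : Sc j = 0 := rfl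

theorem Vec_j : Vec j = 1 := rfl

theorem ext' {W V : Bicomplex} (h1 : Sc W = Sc V) (h2 : Vec W = Vec V) : W = V :=
  WithLp.ofLp_injective 2 (Prod.ext h1 h2)

theorem norm_Sc_le (W : Bicomplex) : ‖Sc W‖ ≤ ‖W‖ := by
  refine le_of_sq_le_sq ?_ (norm_nonneg _)
  rw [WithLp.prod_norm_sq_eq_of_L2]
  exact le_add_of_nonneg_right (sq_nonneg _)

theorem norm_Vec_le (W : Bicomplex) : ‖Vec W‖ ≤ ‖W‖ := by
  refine le_of_sq_le_sq ?_ (norm_nonneg _)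
  rw [WithLp.prod_norm_sq_eq_of_L2]
  exact le_add_of_nonneg_left (sq_nonneg _)

theorem norm_le_add (W : Bicomplex) : ‖W‖ ≤ ‖Sc W‖ + ‖Vec W‖ := by
  refine le_of_sq_le_sq ?_ (by positivity)
  rw [WithLp.prod_norm_sq_eq_of_L2]
  change ‖Sc W‖ ^ 2 + ‖Vec W‖ ^ 2 ≤ _
  nlinarith [norm_nonneg (Sc W), norm_nonneg (Vec W)]

theorem inner_eq_bInner (W V : Bicomplex) : inner ℂ V W = bInner W V := by
  rw [WithLp.prod_inner_apply, bInner_eq]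
  rfl

/-- The idempotent component `u + i v`. -/
noncomputable def compQ : Bicomplex →L[ℝ] ℂ := (scL + I • vecL).restrictScalars ℝ

/-- The conjugate of the idempotent component `u - i v`. -/
noncomputable def compP : Bicomplex →L[ℝ] ℂ :=
  conjCLE.toContinuousLinearMap.comp ((scL - I • vecL).restrictScalars ℝ)

theorem compQ_apply (W : Bicomplex) : compQ W = Sc W + I * Vec W := rfl

theorem compP_apply (W : Bicomplex) : compP W = conj (Sc W - I * Vec W) := rfl

theorem norm_compQ_le (W : Bicomplex) : ‖compQ W‖ ≤ 2 * ‖W‖ := by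
  rw [compQ_apply]
  refine (norm_add_le _ _).trans ?_
  rw [norm_mul, norm_I, one_mul]
  linarith [norm_Sc_le W, norm_Vec_le W]

theorem norm_compP_le (W : Bicomplex) : ‖compP W‖ ≤ 2 * ‖W‖ := by
  rw [compP_apply, norm_conj]
  refine (norm_sub_le _ _).trans ?_
  rw [norm_mul, norm_I, one_mul]
  linarith [norm_Sc_le W, norm_Vec_le W]

theorem norm_le_comp (W : Bicomplex) : ‖W‖ ≤ ‖compP W‖ + ‖compQ W‖ := by
  have h1 : ‖Sc W‖ ≤ (‖compP W‖ + ‖compQ W‖) / 2 := by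
    have : Sc W = (conj (compP W) + compQ W) / 2 := by
      rw [compP_apply, conj_conj, compQ_apply]; ring
    rw [this, norm_div, norm_ofNat]
    gcongr
    exact (norm_add_le _ _).trans_eq (by rw [norm_conj])
  have h2 : ‖Vec W‖ ≤ (‖compP W‖ + ‖compQ W‖) / 2 := by
    have : I * Vec W = (compQ W - conj (compP W)) / 2 := by
      rw [compP_apply, conj_conj, compQ_apply]; ring
    rw [← one_mul ‖Vec W‖, ← norm_I, ← norm_mul, this, norm_div, norm_ofNat]
    gcongr
    exact (norm_sub_le _ _).trans_eq (by rw [norm_conj, add_comm])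
  linarith [norm_le_add W]

/-- The embedding of the scalars as a continuous linear map. -/
noncomputable def ofScalarL : ℂ →L[ℂ] Bicomplex :=
  (WithLp.prodContinuousLinearEquiv 2 ℂ ℂ ℂ).symm.toContinuousLinearMap.comp
    (ContinuousLinearMap.inl ℂ ℂ ℂ)

end Bicomplex

/-! ### The Vekua equation in idempotent components. -/

theorem Sc_dbar (W : ℂ → Bicomplex) (z : ℂ) :
    Sc (dbar W z) = (1 / 2) * (Sc (fderiv ℝ W z 1) - Vec (fderiv ℝ W z I)) := by
  rw [dbar, Sc_smul, Sc_add, Sc_mul, Sc_j, Vec_j]; ring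

theorem Vec_dbar (W : ℂ → Bicomplex) (z : ℂ) :
    Vec (dbar W z) = (1 / 2) * (Vec (fderiv ℝ W z 1) + Sc (fderiv ℝ W z I)) := by
  rw [dbar, Vec_smul, Vec_add, Vec_mul, Sc_j, Vec_j]; ring

/-- The algebra map `j ↦ i` carries the bicomplex operator to the planar `∂̄`; the factor 2 is the
normalisation of `wirtingerBar`. -/
theorem wirtingerBar_compQ {W : ℂ → Bicomplex} {z : ℂ} (hW : DifferentiableAt ℝ W z) :
    wirtingerBar (fun w => compQ (W w)) z = 2 * (Sc (dbar W z) + I * Vec (dbar W z)) := by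
  have h : HasFDerivAt (fun w => compQ (W w)) (compQ.comp (fderiv ℝ W z)) z :=
    compQ.hasFDerivAt.comp z hW.hasFDerivAt
  rw [wirtingerBar, h.fderiv, ContinuousLinearMap.comp_apply, ContinuousLinearMap.comp_apply,
    compQ_apply, compQ_apply, Sc_dbar, Vec_dbar]
  linear_combination Vec (fderiv ℝ W z I) * I_sq

/-- Under `j ↦ -i` the operator becomes the planar `∂`; the conjugation built into `compP` turns it
back into `∂̄`. -/
theorem wirtingerBar_compP {W : ℂ → Bicomplex} {z : ℂ} (hW : DifferentiableAt ℝ W z) :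
    wirtingerBar (fun w => compP (W w)) z = conj (2 * (Sc (dbar W z) - I * Vec (dbar W z))) := by
  have h : HasFDerivAt (fun w => compP (W w)) (compP.comp (fderiv ℝ W z)) z :=
    compP.hasFDerivAt.comp z hW.hasFDerivAt
  rw [wirtingerBar, h.fderiv, ContinuousLinearMap.comp_apply, ContinuousLinearMap.comp_apply,
    compP_apply, compP_apply, Sc_dbar, Vec_dbar]
  simp only [map_sub, map_mul, conj_I, map_add, map_one, map_div₀, map_ofNat]
  linear_combination conj (Vec (fderiv ℝ W z I)) * I_sq

theorem fderiv_ofScalar {f : ℂ → ℂ} {z : ℂ} (hf : DifferentiableAt ℝ f z) (v : ℂ) :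
    fderiv ℝ (fun ζ => ofScalar (f ζ)) z v = ofScalar (fderiv ℝ f z v) := by
  have h : HasFDerivAt (fun w => ofScalar (f w))
      ((ofScalarL.restrictScalars ℝ).comp (fderiv ℝ f z)) z :=
    (ofScalarL.restrictScalars ℝ).hasFDerivAt.comp z hf.hasFDerivAt
  rw [h.fderiv]
  rfl

theorem Sc_dbar_ofScalar {f : ℂ → ℂ} {z : ℂ} (hf : DifferentiableAt ℝ f z) :
    Sc (dbar (fun ζ => ofScalar (f ζ)) z) = (1 / 2) * fderiv ℝ f z 1 := by
  rw [Sc_dbar, fderiv_ofScalar hf, fderiv_ofScalar hf]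
  simp [ofScalar, Sc_mk, Vec_mk]

theorem Vec_dbar_ofScalar {f : ℂ → ℂ} {z : ℂ} (hf : DifferentiableAt ℝ f z) :
    Vec (dbar (fun ζ => ofScalar (f ζ)) z) = (1 / 2) * fderiv ℝ f z I := by
  rw [Vec_dbar, fderiv_ofScalar hf, fderiv_ofScalar hf]
  simp [ofScalar, Sc_mk, Vec_mk]

/-- The coefficient of the Vekua equation for the component `u + i v`. -/
noncomputable def coeffQ (f : ℂ → ℂ) (z : ℂ) : ℂ :=
  (f z)⁻¹ * (fderiv ℝ f z 1 + I * fderiv ℝ f z I)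

/-- The coefficient of the Vekua equation for the conjugate of the component `u - i v`. -/
noncomputable def coeffP (f : ℂ → ℂ) (z : ℂ) : ℂ :=
  conj ((f z)⁻¹ * (fderiv ℝ f z 1 - I * fderiv ℝ f z I))

/-- Bicomplex conjugation exchanges the two idempotent components, hence the coupling of `compQ` to
`compP`. -/
theorem VekuaAt.wirtingerBar_compQ {f : ℂ → ℂ} {W : ℂ → Bicomplex} {z : ℂ} (h : VekuaAt f W z)
    (hf : DifferentiableAt ℝ f z) (hW : DifferentiableAt ℝ W z) :
    wirtingerBar (fun w => compQ (W w)) z = coeffQ f z * conj (compP (W z)) := by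
  rw [_root_.wirtingerBar_compQ hW, show dbar W z = _ from h, compP_apply, conj_conj, Sc_mul, Vec_mul,
    Sc_smul, Vec_smul, Sc_bar, Vec_bar, Sc_dbar_ofScalar hf, Vec_dbar_ofScalar hf, coeffQ]
  linear_combination (f z)⁻¹ * fderiv ℝ f z I * Vec (W z) * I_sq

theorem VekuaAt.wirtingerBar_compP {f : ℂ → ℂ} {W : ℂ → Bicomplex} {z : ℂ} (h : VekuaAt f W z)
    (hf : DifferentiableAt ℝ f z) (hW : DifferentiableAt ℝ W z) :
    wirtingerBar (fun w => compP (W w)) z = coeffP f z * conj (compQ (W z)) := by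
  rw [_root_.wirtingerBar_compP hW, show dbar W z = _ from h, coeffP, ← map_mul, compQ_apply, Sc_mul,
    Vec_mul, Sc_smul, Vec_smul, Sc_bar, Vec_bar, Sc_dbar_ofScalar hf, Vec_dbar_ofScalar hf]
  congr 1
  linear_combination (f z)⁻¹ * fderiv ℝ f z I * Vec (W z) * I_sq

section

variable {Ω : Set ℂ} {f : ℂ → ℂ}

theorem contDiffOn_coeffQ (hΩ : IsOpen Ω) (hf0 : ∀ z ∈ Ω, f z ≠ 0) (hf : ContDiffOn ℝ 2 f Ω) :
    ContDiffOn ℝ 1 (coeffQ f) Ω := by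
  have hD : ContDiffOn ℝ 1 (fderiv ℝ f) Ω := hf.fderiv_of_isOpen hΩ (by norm_num)
  exact ((hf.of_le (by norm_num)).inv hf0).mul
    ((hD.clm_apply contDiffOn_const).add (contDiffOn_const.mul (hD.clm_apply contDiffOn_const)))

theorem contDiffOn_coeffP (hΩ : IsOpen Ω) (hf0 : ∀ z ∈ Ω, f z ≠ 0) (hf : ContDiffOn ℝ 2 f Ω) :
    ContDiffOn ℝ 1 (coeffP f) Ω := by
  have hD : ContDiffOn ℝ 1 (fderiv ℝ f) Ω := hf.fderiv_of_isOpen hΩ (by norm_num)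
  have h : ContDiffOn ℝ 1 (fun z => (f z)⁻¹ * (fderiv ℝ f z 1 - I * fderiv ℝ f z I)) Ω :=
    ((hf.of_le (by norm_num)).inv hf0).mul
      ((hD.clm_apply contDiffOn_const).sub (contDiffOn_const.mul (hD.clm_apply contDiffOn_const)))
  exact conjCLE.toContinuousLinearMap.contDiff.comp_contDiffOn h

theorem norm_le_comp_fderiv {W : ℂ → Bicomplex} {z : ℂ} (hW : DifferentiableAt ℝ W z) :
    ‖fderiv ℝ W z‖ ≤ ‖fderiv ℝ (fun w => compP (W w)) z‖ + ‖fderiv ℝ (fun w => compQ (W w)) z‖ := by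
  have h1 : HasFDerivAt (fun w => compP (W w)) (compP.comp (fderiv ℝ W z)) z :=
    compP.hasFDerivAt.comp z hW.hasFDerivAt
  have h2 : HasFDerivAt (fun w => compQ (W w)) (compQ.comp (fderiv ℝ W z)) z :=
    compQ.hasFDerivAt.comp z hW.hasFDerivAt
  rw [h1.fderiv, h2.fderiv]
  refine ContinuousLinearMap.opNorm_le_bound _ (by positivity) fun v => ?_
  rw [add_mul]
  exact (norm_le_comp _).trans (add_le_add ((compP.comp (fderiv ℝ W z)).le_opNorm v)
    ((compQ.comp (fderiv ℝ W z)).le_opNorm v))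

theorem integrableOn_norm_sq {W : ℂ → Bicomplex} (hW : MemLp W 2 (volume.restrict Ω)) :
    IntegrableOn (fun z => ‖W z‖ ^ 2) Ω :=
  hW.integrable_norm_pow (p := 2) two_ne_zero

/-- The interior estimate for the square integrable solutions of the main Vekua equation. -/
theorem exists_bergman_estimate (hΩ : IsOpen Ω) (hf0 : ∀ z ∈ Ω, f z ≠ 0)
    (hf : ContDiffOn ℝ 2 f Ω) {z₀ : ℂ} (hz₀ : z₀ ∈ Ω) :
    ∃ R > 0, closedBall z₀ R ⊆ Ω ∧ ∃ C : ℝ, 0 < C ∧ ∀ W ∈ BergmanSpace Ω f,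
      ∀ z ∈ closedBall z₀ R, ‖W z‖ ≤ C * l2Norm Ω W ∧ ‖fderiv ℝ W z‖ ≤ C * l2Norm Ω W := by
  obtain ⟨R, hR, hRΩ, C, hC, H⟩ := exists_interior_estimate hΩ (contDiffOn_coeffP hΩ hf0 hf)
    (contDiffOn_coeffQ hΩ hf0 hf) hz₀
  -- The factor 2 comes from `‖compP W‖, ‖compQ W‖ ≤ 2 * ‖W‖`.
  refine ⟨R, hR, hRΩ, C * 2, by positivity, fun W hW z hz => ?_⟩
  have hd : ∀ w ∈ Ω, DifferentiableAt ℝ W w := fun w hw =>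
    (hW.1.1.differentiableOn one_ne_zero).differentiableAt (hΩ.mem_nhds hw)
  have hdf : ∀ w ∈ Ω, DifferentiableAt ℝ f w := fun w hw =>
    (hf.differentiableOn two_ne_zero).differentiableAt (hΩ.mem_nhds hw)
  have hi := integrableOn_norm_sq hW.2
  have hcomp : ∀ L : Bicomplex →L[ℝ] ℂ, (∀ V, ‖L V‖ ≤ 2 * ‖V‖) →
      ContDiffOn ℝ 1 (fun w => L (W w)) Ω ∧ IntegrableOn (fun w => ‖L (W w)‖ ^ 2) Ω ∧
      √(∫ w in Ω, ‖L (W w)‖ ^ 2) ≤ 2 * l2Norm Ω W := by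
    intro L hL
    have hsq : ∀ w, ‖L (W w)‖ ^ 2 ≤ 2 ^ 2 * ‖W w‖ ^ 2 := fun w => by
      rw [← mul_pow]
      exact pow_le_pow_left₀ (norm_nonneg _) (hL _) 2
    have hc : ContDiffOn ℝ 1 (fun w => L (W w)) Ω := L.contDiff.comp_contDiffOn hW.1.1
    have hint : IntegrableOn (fun w => ‖L (W w)‖ ^ 2) Ω := by
      refine (hi.const_mul (2 ^ 2)).mono'
        ((hc.continuousOn.norm.pow 2).aestronglyMeasurable hΩ.measurableSet) (.of_forall fun w => ?_)
      rw [Real.norm_of_nonneg (by positivity)]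
      exact hsq w
    refine ⟨hc, hint, ?_⟩
    rw [l2Norm, ← Real.sqrt_sq (zero_le_two (α := ℝ)), ← Real.sqrt_mul (by positivity),
      ← integral_const_mul]
    exact Real.sqrt_le_sqrt (integral_mono hint (hi.const_mul _) hsq)
  obtain ⟨p1, p2, p3⟩ := hcomp compP norm_compP_le
  obtain ⟨q1, q2, q3⟩ := hcomp compQ norm_compQ_le
  obtain ⟨h1, h2⟩ := H _ _ _ p1 q1
    (fun w hw => (hW.1.2 w hw).wirtingerBar_compP (hdf w hw) (hd w hw))
    (fun w hw => (hW.1.2 w hw).wirtingerBar_compQ (hdf w hw) (hd w hw)) p2 q2 p3 q3 z hz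
  rw [mul_assoc]
  exact ⟨(norm_le_comp _).trans h1, (norm_le_comp_fderiv (hd z (hRΩ hz))).trans h2⟩

end

/-! ### The Bergman space as a closed complex subspace of `L₂`. -/

/-- In this form the equation is visibly `ℂ`-linear in `W` and its derivative, and stable under
pointwise limits of both. -/
theorem vekuaAt_iff {f : ℂ → ℂ} {W : ℂ → Bicomplex} {z : ℂ} :
    VekuaAt f W z ↔
      (1 / 2 : ℂ) * (Sc (fderiv ℝ W z 1) - Vec (fderiv ℝ W z I)) =
        Sc ((f z)⁻¹ • dbar (fun ζ => ofScalar (f ζ)) z) * Sc (W z) +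
          Vec ((f z)⁻¹ • dbar (fun ζ => ofScalar (f ζ)) z) * Vec (W z) ∧
      (1 / 2 : ℂ) * (Vec (fderiv ℝ W z 1) + Sc (fderiv ℝ W z I)) =
        Vec ((f z)⁻¹ • dbar (fun ζ => ofScalar (f ζ)) z) * Sc (W z) -
          Sc ((f z)⁻¹ • dbar (fun ζ => ofScalar (f ζ)) z) * Vec (W z) := by
  rw [← Sc_dbar, ← Vec_dbar, VekuaAt]
  constructor
  · intro h
    rw [h, Sc_mul, Vec_mul, Sc_bar, Vec_bar]
    constructor <;> ring
  · rintro ⟨h1, h2⟩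
    refine Bicomplex.ext' ?_ ?_
    · rw [h1, Sc_mul, Sc_bar, Vec_bar]; ring
    · rw [h2, Vec_mul, Sc_bar, Vec_bar]; ring

section

variable {Ω : Set ℂ} {f : ℂ → ℂ}

theorem BergmanSpace.differentiableAt (hΩ : IsOpen Ω) {W : ℂ → Bicomplex}
    (hW : W ∈ BergmanSpace Ω f) {z : ℂ} (hz : z ∈ Ω) : DifferentiableAt ℝ W z :=
  (hW.1.1.differentiableOn one_ne_zero).differentiableAt (hΩ.mem_nhds hz)

theorem BergmanSpace.zero_mem : (0 : ℂ → Bicomplex) ∈ BergmanSpace Ω f := by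
  refine ⟨⟨contDiffOn_const, fun z _ => vekuaAt_iff.2 ?_⟩, MemLp.zero⟩
  have h : fderiv ℝ (0 : ℂ → Bicomplex) z = 0 := fderiv_const_apply 0
  rw [h]
  simp [Sc, Vec]

theorem BergmanSpace.add_mem (hΩ : IsOpen Ω) {W V : ℂ → Bicomplex} (hW : W ∈ BergmanSpace Ω f)
    (hV : V ∈ BergmanSpace Ω f) : W + V ∈ BergmanSpace Ω f := by
  refine ⟨⟨hW.1.1.add hV.1.1, fun z hz => vekuaAt_iff.2 ?_⟩, hW.2.add hV.2⟩
  rw [fderiv_add (BergmanSpace.differentiableAt hΩ hW hz)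
    (BergmanSpace.differentiableAt hΩ hV hz)]
  obtain ⟨h1, h2⟩ := vekuaAt_iff.1 (hW.1.2 z hz)
  obtain ⟨h3, h4⟩ := vekuaAt_iff.1 (hV.1.2 z hz)
  simp only [add_apply, Pi.add_apply, Sc_add, Vec_add]
  exact ⟨by linear_combination h1 + h3, by linear_combination h2 + h4⟩

theorem BergmanSpace.smul_mem (hΩ : IsOpen Ω) (c : ℂ) {W : ℂ → Bicomplex}
    (hW : W ∈ BergmanSpace Ω f) : c • W ∈ BergmanSpace Ω f := by
  refine ⟨⟨contDiffOn_const.smul hW.1.1, fun z hz => vekuaAt_iff.2 ?_⟩, hW.2.const_smul c⟩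
  rw [fderiv_const_smul (BergmanSpace.differentiableAt hΩ hW hz)]
  obtain ⟨h1, h2⟩ := vekuaAt_iff.1 (hW.1.2 z hz)
  simp only [smul_apply, Pi.smul_apply, Sc_smul, Vec_smul]
  simp only [Sc_smul, Vec_smul] at h1 h2
  exact ⟨by linear_combination c * h1, by linear_combination c * h2⟩

theorem BergmanSpace.sub_mem (hΩ : IsOpen Ω) {W V : ℂ → Bicomplex} (hW : W ∈ BergmanSpace Ω f)
    (hV : V ∈ BergmanSpace Ω f) : W - V ∈ BergmanSpace Ω f := by
  rw [sub_eq_add_neg, ← neg_one_smul ℂ V]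
  exact BergmanSpace.add_mem hΩ hW (BergmanSpace.smul_mem hΩ (-1) hV)

/-- The arguments are swapped because `inner` is linear in its second argument and `bInner` in its
first. -/
theorem inner_eq_l2Inner {g h : Lp Bicomplex 2 (volume.restrict Ω)} {W V : ℂ → Bicomplex}
    (hg : g =ᵐ[volume.restrict Ω] W) (hh : h =ᵐ[volume.restrict Ω] V) :
    inner ℂ h g = l2Inner Ω W V := by
  rw [L2.inner_def, l2Inner]
  refine integral_congr_ae ?_
  filter_upwards [hg, hh] with z h1 h2
  rw [h1, h2, inner_eq_bInner]

theorem l2Norm_eq_norm {g : Lp Bicomplex 2 (volume.restrict Ω)} {W : ℂ → Bicomplex}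
    (hg : g =ᵐ[volume.restrict Ω] W) : l2Norm Ω W = ‖g‖ := by
  have h := inner_eq_l2Inner hg hg
  rw [l2Inner] at h
  simp only [bInner_self] at h
  rw [integral_complex_ofReal] at h
  have h' : ‖g‖ ^ 2 = ∫ z in Ω, ‖W z‖ ^ 2 := by
    rw [← inner_self_eq_norm_sq (𝕜 := ℂ) g, h]
    rfl
  rw [l2Norm, ← h', Real.sqrt_sq (norm_nonneg _)]

theorem integrableOn_bInner {W V : ℂ → Bicomplex} (hW : MemLp W 2 (volume.restrict Ω))
    (hV : MemLp V 2 (volume.restrict Ω)) : IntegrableOn (fun z => bInner (W z) (V z)) Ω := by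
  refine (L2.integrable_inner (𝕜 := ℂ) (hV.toLp V) (hW.toLp W)).congr ?_
  filter_upwards [hW.coeFn_toLp, hV.coeFn_toLp] with z h1 h2
  rw [h1, h2, inner_eq_bInner]

theorem l2Inner_conj_symm (W V : ℂ → Bicomplex) : l2Inner Ω W V = conj (l2Inner Ω V W) := by
  rw [l2Inner, l2Inner, ← integral_conj]
  refine integral_congr_ae (.of_forall fun z => ?_)
  simp only [bInner_eq, map_add, map_mul, conj_conj]
  ring

/-- A limit in `L₂` of elements of the Bergman space is represented by an element of the Bergman
space. -/
theorem exists_bergman_of_tendsto (hΩ : IsOpen Ω) (hf0 : ∀ z ∈ Ω, f z ≠ 0)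
    (hf : ContDiffOn ℝ 2 f Ω) {g : ℕ → Lp Bicomplex 2 (volume.restrict Ω)}
    {g₀ : Lp Bicomplex 2 (volume.restrict Ω)} (hg : Tendsto g atTop (𝓝 g₀))
    {W : ℕ → ℂ → Bicomplex} (hW : ∀ n, W n ∈ BergmanSpace Ω f)
    (hgW : ∀ n, g n =ᵐ[volume.restrict Ω] W n) :
    ∃ V ∈ BergmanSpace Ω f, g₀ =ᵐ[volume.restrict Ω] V := by
  have hd : ∀ n, ∀ z ∈ Ω, DifferentiableAt ℝ (W n) z := fun n z hz =>
    BergmanSpace.differentiableAt hΩ (hW n) hz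
  have hnorm : ∀ m n, l2Norm Ω (W m - W n) = ‖g m - g n‖ := fun m n =>
    l2Norm_eq_norm ((Lp.coeFn_sub _ _).trans ((hgW m).sub (hgW n)))
  have hcs := hg.cauchySeq
  have hlocal : ∀ z₀ ∈ Ω, ∃ R > 0, closedBall z₀ R ⊆ Ω ∧
      UniformCauchySeqOn W atTop (ball z₀ R) ∧
      UniformCauchySeqOn (fun n => fderiv ℝ (W n)) atTop (ball z₀ R) := by
    intro z₀ hz₀
    obtain ⟨R, hR, hRΩ, C, hC, H⟩ := exists_bergman_estimate hΩ hf0 hf hz₀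
    have hsmall : ∀ ε > 0, ∃ N, ∀ m ≥ N, ∀ n ≥ N, C * l2Norm Ω (W m - W n) < ε := by
      intro ε hε
      obtain ⟨N, hN⟩ := Metric.cauchySeq_iff.1 hcs (ε / C) (by positivity)
      refine ⟨N, fun m hm n hn => ?_⟩
      rw [hnorm, ← dist_eq_norm, mul_comm, ← lt_div_iff₀ hC]
      exact hN m hm n hn
    refine ⟨R, hR, hRΩ, ?_, ?_⟩
    · rw [Metric.uniformCauchySeqOn_iff]
      intro ε hε
      obtain ⟨N, hN⟩ := hsmall ε hε
      refine ⟨N, fun m hm n hn z hz => ?_⟩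
      rw [dist_eq_norm]
      exact (H _ (BergmanSpace.sub_mem hΩ (hW m) (hW n)) z
        (ball_subset_closedBall hz)).1.trans_lt (hN m hm n hn)
    · rw [Metric.uniformCauchySeqOn_iff]
      intro ε hε
      obtain ⟨N, hN⟩ := hsmall ε hε
      refine ⟨N, fun m hm n hn z hz => ?_⟩
      have hzΩ := hRΩ (ball_subset_closedBall hz)
      rw [dist_eq_norm, ← fderiv_sub (hd m z hzΩ) (hd n z hzΩ)]
      exact (H _ (BergmanSpace.sub_mem hΩ (hW m) (hW n)) z
        (ball_subset_closedBall hz)).2.trans_lt (hN m hm n hn)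
  have hlim : ∀ z, ∃ (w : Bicomplex) (L : ℂ →L[ℝ] Bicomplex), z ∈ Ω →
      Tendsto (fun n => W n z) atTop (𝓝 w) ∧
      Tendsto (fun n => fderiv ℝ (W n) z) atTop (𝓝 L) := by
    intro z
    by_cases hz : z ∈ Ω
    · obtain ⟨R, hR, -, h1, h2⟩ := hlocal z hz
      obtain ⟨w, hw⟩ := cauchySeq_tendsto_of_complete (h1.cauchySeq (mem_ball_self hR))
      obtain ⟨L, hL⟩ := cauchySeq_tendsto_of_complete (h2.cauchySeq (mem_ball_self hR))
      exact ⟨w, L, fun _ => ⟨hw, hL⟩⟩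
    · exact ⟨0, 0, fun h => absurd h hz⟩
  choose V D hVD using hlim
  have hderiv : ∀ z ∈ Ω, HasFDerivAt V (D z) z ∧ ContinuousAt D z := by
    intro z hz
    obtain ⟨R, hR, hRΩ, -, h2⟩ := hlocal z hz
    have hball : ∀ x ∈ ball z R, x ∈ Ω := fun x hx => hRΩ (ball_subset_closedBall hx)
    have hu := h2.tendstoUniformlyOn_of_tendsto fun x hx => (hVD x (hball x hx)).2
    refine ⟨hasFDerivAt_of_tendstoUniformlyOn isOpen_ball hu
      (fun n x hx => (hd n x (hball x hx)).hasFDerivAt)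
      (fun x hx => (hVD x (hball x hx)).1) (mem_ball_self hR), ?_⟩
    refine (hu.continuousOn (Frequently.of_forall fun n => ?_)).continuousAt (ball_mem_nhds z hR)
    exact ((hW n).1.1.continuousOn_fderiv_of_isOpen hΩ le_rfl).mono hball
  have hV1 : ContDiffOn ℝ 1 V Ω := by
    rw [show (1 : WithTop ℕ∞) = 0 + 1 from rfl, contDiffOn_succ_iff_fderiv_of_isOpen hΩ]
    refine ⟨fun z hz => (hderiv z hz).1.differentiableAt.differentiableWithinAt, by simp, ?_⟩
    rw [contDiffOn_zero]
    refine ContinuousOn.congr (f := D) ?_ fun z hz => (hderiv z hz).1.fderiv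
    exact fun z hz => (hderiv z hz).2.continuousWithinAt
  have hae : g₀ =ᵐ[volume.restrict Ω] V := by
    -- An almost everywhere convergent subsequence identifies the `L₂` limit with the locally
    -- uniform one.
    obtain ⟨ns, hns, hconv⟩ := (tendstoInMeasure_of_tendsto_Lp hg).exists_seq_tendsto_ae
    have hall : ∀ᵐ z ∂volume.restrict Ω, ∀ n, g n z = W n z := ae_all_iff.2 hgW
    filter_upwards [hconv, hall, ae_restrict_mem hΩ.measurableSet] with z h1 h2 h3
    simp only [h2] at h1
    exact tendsto_nhds_unique h1 ((hVD z h3).1.comp hns.tendsto_atTop)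
  refine ⟨V, ⟨⟨hV1, fun z hz => vekuaAt_iff.2 ?_⟩, (memLp_congr_ae hae).1 (Lp.memLp g₀)⟩, hae⟩
  obtain ⟨hVz, hDz⟩ := hVD z hz
  rw [(hderiv z hz).1.fderiv]
  have hS : Tendsto (fun n => Sc (W n z)) atTop (𝓝 (Sc (V z))) :=
    (scL.continuous.tendsto _).comp hVz
  have hT : Tendsto (fun n => Vec (W n z)) atTop (𝓝 (Vec (V z))) :=
    (vecL.continuous.tendsto _).comp hVz
  have hDS : ∀ v, Tendsto (fun n => Sc (fderiv ℝ (W n) z v)) atTop (𝓝 (Sc (D z v))) := fun v =>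
    (scL.continuous.tendsto _).comp (((ContinuousLinearMap.apply ℝ _ v).continuous.tendsto _).comp hDz)
  have hDT : ∀ v, Tendsto (fun n => Vec (fderiv ℝ (W n) z v)) atTop (𝓝 (Vec (D z v))) := fun v =>
    (vecL.continuous.tendsto _).comp (((ContinuousLinearMap.apply ℝ _ v).continuous.tendsto _).comp hDz)
  have heq := fun n => vekuaAt_iff.1 ((hW n).1.2 z hz)
  constructor
  · refine tendsto_nhds_unique (((hDS 1).sub (hDT I)).const_mul _) ?_
    simp only [fun n => (heq n).1]
    exact (hS.const_mul _).add (hT.const_mul _)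
  · refine tendsto_nhds_unique (((hDT 1).add (hDS I)).const_mul _) ?_
    simp only [fun n => (heq n).2]
    exact (hS.const_mul _).sub (hT.const_mul _)

/-! ### Reproducing kernels. -/

/-- The Bergman space as a subspace of the Hilbert space `L₂(Ω; 𝔹)`. -/
noncomputable def bergmanSubmodule (hΩ : IsOpen Ω) (f : ℂ → ℂ) :
    Submodule ℂ (Lp Bicomplex 2 (volume.restrict Ω)) where
  carrier := {g | ∃ W ∈ BergmanSpace Ω f, g =ᵐ[volume.restrict Ω] W}
  zero_mem' := ⟨0, BergmanSpace.zero_mem, Lp.coeFn_zero _ _ _⟩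
  add_mem' := by
    rintro g h ⟨W, hW, hgW⟩ ⟨V, hV, hhV⟩
    exact ⟨W + V, BergmanSpace.add_mem hΩ hW hV, (Lp.coeFn_add _ _).trans (hgW.add hhV)⟩
  smul_mem' := by
    rintro c g ⟨W, hW, hgW⟩
    exact ⟨c • W, BergmanSpace.smul_mem hΩ c hW, (Lp.coeFn_smul _ _).trans (hgW.const_smul c)⟩

theorem isClosed_bergmanSubmodule (hΩ : IsOpen Ω) (hf0 : ∀ z ∈ Ω, f z ≠ 0)
    (hf : ContDiffOn ℝ 2 f Ω) :
    IsClosed (bergmanSubmodule hΩ f : Set (Lp Bicomplex 2 (volume.restrict Ω))) := by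
  refine IsSeqClosed.isClosed fun g g₀ hg hlim => ?_
  choose W hW hgW using hg
  exact exists_bergman_of_tendsto hΩ hf0 hf hlim hW hgW

theorem BergmanSpace.eqOn_of_ae_eq (hΩ : IsOpen Ω) {W V : ℂ → Bicomplex}
    (hW : W ∈ BergmanSpace Ω f) (hV : V ∈ BergmanSpace Ω f) (h : W =ᵐ[volume.restrict Ω] V) :
    EqOn W V Ω :=
  Measure.eqOn_open_of_ae_eq h hΩ hW.1.1.continuousOn hV.1.1.continuousOn

/-- A continuous linear functional of the value at a point is represented by an element of the
Bergman space. -/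
theorem exists_reproducing (hΩ : IsOpen Ω) (hf0 : ∀ z ∈ Ω, f z ≠ 0) (hf : ContDiffOn ℝ 2 f Ω)
    (ℓ : Bicomplex →L[ℂ] ℂ) {z : ℂ} (hz : z ∈ Ω) :
    ∃ K ∈ BergmanSpace Ω f, ∀ W ∈ BergmanSpace Ω f, ℓ (W z) = l2Inner Ω W K := by
  obtain ⟨R, hR, -, C, hC, H⟩ := exists_bergman_estimate hΩ hf0 hf hz
  let S := bergmanSubmodule hΩ f
  have : CompleteSpace S := (isClosed_bergmanSubmodule hΩ hf0 hf).completeSpace_coe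
  choose rep hrep hae using fun g : S => g.2
  -- The choice `rep` need not be linear as a choice of functions, but continuous representatives
  -- are unique on `Ω`, so evaluation at `z` is linear.
  let F : S →ₗ[ℂ] ℂ :=
    { toFun := fun g => ℓ (rep g z)
      map_add' := fun g h => by
        rw [← map_add]
        congr 1
        refine BergmanSpace.eqOn_of_ae_eq hΩ (hrep _) (BergmanSpace.add_mem hΩ (hrep g) (hrep h))
          ?_ hz
        exact (hae (g + h)).symm.trans ((Lp.coeFn_add _ _).trans ((hae g).add (hae h)))
      map_smul' := fun c g => by
        rw [RingHom.id_apply, ← map_smul]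
        congr 1
        refine BergmanSpace.eqOn_of_ae_eq hΩ (hrep _) (BergmanSpace.smul_mem hΩ c (hrep g)) ?_ hz
        exact (hae (c • g)).symm.trans ((Lp.coeFn_smul _ _).trans ((hae g).const_smul c)) }
  let F' : StrongDual ℂ S := F.mkContinuous (‖ℓ‖ * C) fun g => by
    refine (ℓ.le_opNorm _).trans ?_
    rw [mul_assoc]
    refine mul_le_mul_of_nonneg_left ?_ (norm_nonneg _)
    have h1 := (H (rep g) (hrep g) z (mem_closedBall_self hR.le)).1
    rwa [l2Norm_eq_norm (hae g)] at h1
  let k := (InnerProductSpace.toDual ℂ S).symm F'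
  refine ⟨rep k, hrep k, fun W hW => ?_⟩
  let g : S := ⟨hW.2.toLp W, W, hW, hW.2.coeFn_toLp⟩
  have h1 : inner ℂ k g = ℓ (rep g z) := InnerProductSpace.toDual_symm_apply
  have h2 : rep g z = W z :=
    BergmanSpace.eqOn_of_ae_eq hΩ (hrep g) hW ((hae g).symm.trans hW.2.coeFn_toLp) hz
  rw [← h2, ← h1, Submodule.coe_inner]
  exact inner_eq_l2Inner hW.2.coeFn_toLp (hae k)

/-- Testing with `W = K - K'` gives a difference of norm zero; continuity then gives equality
everywhere on `Ω`. -/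
theorem eqOn_of_l2Inner_eq (hΩ : IsOpen Ω) {K K' : ℂ → Bicomplex} (hK : K ∈ BergmanSpace Ω f)
    (hK' : K' ∈ BergmanSpace Ω f)
    (h : ∀ W ∈ BergmanSpace Ω f, l2Inner Ω W K = l2Inner Ω W K') : EqOn K K' Ω := by
  have hD := BergmanSpace.sub_mem hΩ hK hK'
  have h1 := h _ hD
  rw [← inner_eq_l2Inner hD.2.coeFn_toLp hK.2.coeFn_toLp,
    ← inner_eq_l2Inner hD.2.coeFn_toLp hK'.2.coeFn_toLp, ← sub_eq_zero, ← inner_sub_left,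
    MemLp.toLp_sub hK.2 hK'.2, inner_self_eq_zero, sub_eq_zero] at h1
  refine BergmanSpace.eqOn_of_ae_eq hΩ hK hK' (hK.2.coeFn_toLp.symm.trans ?_)
  rw [h1]
  exact hK'.2.coeFn_toLp

theorem exists_bound_on_compact (hΩ : IsOpen Ω) (hf0 : ∀ z ∈ Ω, f z ≠ 0)
    (hf : ContDiffOn ℝ 2 f Ω) {K : Set ℂ} (hK : IsCompact K) (hKΩ : K ⊆ Ω) :
    ∃ C : ℝ, 0 < C ∧ ∀ W ∈ BergmanSpace Ω f, ∀ z ∈ K, ‖W z‖ ≤ C * l2Norm Ω W := by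
  refine hK.induction_on (p := fun s => ∃ C : ℝ, 0 < C ∧ ∀ W ∈ BergmanSpace Ω f, ∀ z ∈ s,
    ‖W z‖ ≤ C * l2Norm Ω W) ⟨1, one_pos, fun _ _ _ h => absurd h (notMem_empty _)⟩ ?_ ?_ ?_
  · rintro s t hst ⟨C, hC, h⟩
    exact ⟨C, hC, fun W hW z hz => h W hW z (hst hz)⟩
  · rintro s t ⟨C, hC, h⟩ ⟨C', hC', h'⟩
    refine ⟨max C C', lt_max_of_lt_left hC, fun W hW z hz => ?_⟩
    have h0 : 0 ≤ l2Norm Ω W := Real.sqrt_nonneg _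
    rcases hz with hz | hz
    · exact (h W hW z hz).trans (mul_le_mul_of_nonneg_right (le_max_left _ _) h0)
    · exact (h' W hW z hz).trans (mul_le_mul_of_nonneg_right (le_max_right _ _) h0)
  · intro z hz
    obtain ⟨R, hR, -, C, hC, H⟩ := exists_bergman_estimate hΩ hf0 hf (hKΩ hz)
    exact ⟨closedBall z R, mem_nhdsWithin_of_mem_nhds (closedBall_mem_nhds z hR), C, hC,
      fun W hW w hw => (H W hW w hw).1⟩

/-- The Bergman kernel in terms of the inner products with the kernels at the first variable. -/
theorem bergmanKernel_eq_mk {K L : ℂ → ℂ → Bicomplex} (hK : ∀ z ∈ Ω, IsScKernel Ω f z (K z))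
    (hL : ∀ z ∈ Ω, IsVecKernel Ω f z (L z)) (A : Bicomplex) {z ζ : ℂ} (hz : z ∈ Ω) (hζ : ζ ∈ Ω) :
    bergmanKernel K L A z ζ = mk (bInner A (K z ζ)) (bInner A (L z ζ)) := by
  -- Each kernel is itself in the space: reproducing `K ζ` at `z` and `K z` at `ζ` gives the same
  -- inner product up to conjugation. The other three identities follow in the same way.
  have h1 : Sc (K ζ z) = conj (Sc (K z ζ)) := by
    rw [(hK z hz).2 _ (hK ζ hζ).1, (hK ζ hζ).2 _ (hK z hz).1, l2Inner_conj_symm]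
  have h2 : Vec (K ζ z) = conj (Sc (L z ζ)) := by
    rw [(hL z hz).2 _ (hK ζ hζ).1, (hK ζ hζ).2 _ (hL z hz).1, l2Inner_conj_symm]
  have h3 : Sc (L ζ z) = conj (Vec (K z ζ)) := by
    rw [(hK z hz).2 _ (hL ζ hζ).1, (hL ζ hζ).2 _ (hK z hz).1, l2Inner_conj_symm]
  have h4 : Vec (L ζ z) = conj (Vec (L z ζ)) := by
    rw [(hL z hz).2 _ (hL ζ hζ).1, (hL ζ hζ).2 _ (hL z hz).1, l2Inner_conj_symm]
  refine Bicomplex.ext' ?_ ?_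
  · rw [bergmanKernel, Sc_add, Sc_smul, Sc_smul, Sc_mk, bInner_eq, h1, h3]
  · rw [bergmanKernel, Vec_add, Vec_smul, Vec_smul, Vec_mk, bInner_eq, h2, h4]

theorem integral_mk {a b : ℂ → ℂ} (ha : IntegrableOn a Ω) (hb : IntegrableOn b Ω) :
    IntegrableOn (fun z => mk (a z) (b z)) Ω ∧
      ∫ z in Ω, mk (a z) (b z) = mk (∫ z in Ω, a z) (∫ z in Ω, b z) := by
  let e := (WithLp.prodContinuousLinearEquiv 2 ℂ ℂ ℂ).symm.toContinuousLinearMap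
  have hi : IntegrableOn (fun z => mk (a z) (b z)) Ω :=
    e.integrable_comp (φ := fun z => (a z, b z)) (ha.prodMk hb)
  refine ⟨hi, Bicomplex.ext' ?_ ?_⟩
  · exact (scL.integral_comp_comm hi).symm
  · exact (vecL.integral_comp_comm hi).symm

end

end

theorem mainTheorem8 (Ω : Set ℂ) (hΩo : IsOpen Ω) (hΩc : IsConnected Ω)
    (hΩb : Bornology.IsBounded Ω) (f : ℂ → ℂ) (hf0 : ∀ z ∈ Ω, f z ≠ 0)
    (hf1 : IsC1Closure Ω f) (hf2 : ContDiffOn ℝ 2 f Ω) (hfW : MemSobolevInf Ω 2 f) :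
    -- the uniform estimate on compact subsets
    (∀ K : Set ℂ, IsCompact K → K ⊆ Ω → ∃ C : ℝ, 0 < C ∧
      ∀ W ∈ BergmanSpace Ω f, ∀ z ∈ K, ‖W z‖ ≤ C * l2Norm Ω W) ∧
    -- the point evaluations are bounded
    (∀ z ∈ Ω, ∃ C : ℝ, ∀ W ∈ BergmanSpace Ω f,
      ‖Sc (W z)‖ ≤ C * l2Norm Ω W ∧ ‖Vec (W z)‖ ≤ C * l2Norm Ω W) ∧
    -- the reproducing kernels exist, are unique on `Ω`, and give the Bergman kernel
    (∃ K L : ℂ → ℂ → Bicomplex,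
      (∀ z ∈ Ω, IsScKernel Ω f z (K z) ∧ ∀ K', IsScKernel Ω f z K' → EqOn K' (K z) Ω) ∧
      (∀ z ∈ Ω, IsVecKernel Ω f z (L z) ∧ ∀ L', IsVecKernel Ω f z L' → EqOn L' (L z) Ω) ∧
      (∀ A : Bicomplex, ∀ ζ ∈ Ω, (fun z => bergmanKernel K L A z ζ) ∈ BergmanSpace Ω f) ∧
      (∀ W ∈ BergmanSpace Ω f, ∀ z ∈ Ω,
        IntegrableOn (fun ζ => bergmanKernel K L (W ζ) z ζ) Ω ∧
        W z = ∫ ζ in Ω, bergmanKernel K L (W ζ) z ζ)) := by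
  have hker := fun (ℓ : Bicomplex →L[ℂ] ℂ) z => exists_reproducing hΩo hf0 hf2 ℓ (z := z)
  refine ⟨fun K hK hKΩ => exists_bound_on_compact hΩo hf0 hf2 hK hKΩ, fun z hz => ?_, ?_⟩
  · obtain ⟨C, -, h⟩ := exists_bound_on_compact hΩo hf0 hf2 isCompact_singleton
       (singleton_subset_iff.2 hz)
    exact ⟨C, fun W hW => ⟨(norm_Sc_le _).trans (h W hW z rfl),
      (norm_Vec_le _).trans (h W hW z rfl)⟩⟩
  have hK' : ∀ z, ∃ K, z ∈ Ω → IsScKernel Ω f z K := fun z => by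
    by_cases hz : z ∈ Ω
    · obtain ⟨K, hK⟩ := hker scL z hz
      exact ⟨K, fun _ => hK⟩
    · exact ⟨0, fun h => absurd h hz⟩
  have hL' : ∀ z, ∃ L, z ∈ Ω → IsVecKernel Ω f z L := fun z => by
    by_cases hz : z ∈ Ω
    · obtain ⟨L, hL⟩ := hker vecL z hz
      exact ⟨L, fun _ => hL⟩
    · exact ⟨0, fun h => absurd h hz⟩
  choose K hK using hK'
  choose L hL using hL'
  refine ⟨K, L, fun z hz => ⟨hK z hz, fun K' hK' => ?_⟩, fun z hz => ⟨hL z hz, fun L' hL' => ?_⟩,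
    fun A ζ hζ => ?_, fun W hW z hz => ?_⟩
  · exact eqOn_of_l2Inner_eq hΩo hK'.1 (hK z hz).1 fun W hW =>
      (hK'.2 W hW).symm.trans ((hK z hz).2 W hW)
  · exact eqOn_of_l2Inner_eq hΩo hL'.1 (hL z hz).1 fun W hW =>
      (hL'.2 W hW).symm.trans ((hL z hz).2 W hW)
  · exact BergmanSpace.add_mem hΩo (BergmanSpace.smul_mem hΩo _ (hK ζ hζ).1)
      (BergmanSpace.smul_mem hΩo _ (hL ζ hζ).1)
  -- By the symmetry of the kernels, the integrand has as components the two integrands that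
  -- reproduce `Sc (W z)` and `Vec (W z)`.
  · have heq : EqOn (fun ζ => bergmanKernel K L (W ζ) z ζ)
        (fun ζ => mk (bInner (W ζ) (K z ζ)) (bInner (W ζ) (L z ζ))) Ω := fun ζ hζ =>
      bergmanKernel_eq_mk hK hL (W ζ) hz hζ
    obtain ⟨hi, hint⟩ := integral_mk (integrableOn_bInner hW.2 (hK z hz).1.2)
      (integrableOn_bInner hW.2 (hL z hz).1.2)
    refine ⟨hi.congr_fun heq.symm hΩo.measurableSet, ?_⟩
    rw [setIntegral_congr_fun hΩo.measurableSet heq, hint]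
    exact Bicomplex.ext' ((hK z hz).2 W hW) ((hL z hz).2 W hW)
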